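/- Conventions. For a path-connected topological space $X$, a local system on $X$ is a functor from the fundamental groupoid of $X$ to complex vector spaces (equivalently, after a choice of base point, a complex representation of $\pi_1(X)$). It has rank $n$ if its fibres have dimension $n$, and it is semisimple if its monodromy representation is. $H^k(X,V)$ denotes singular cohomology with coefficients in the local system $V$. Let $M_B(X,n)$ be the set of isomorphism classes of semisimple local systems of rank $n$ on $X$ (for $n=0$ it consists of the zero local system), and for $k,m\ge 0$ let $$\Sigma^k_{m,B}(X,n)=\{[V]\in M_B(X,n) : \dim_{\mathbb C} H^k(X,V)\ge m\}.$$ For isomorphism classes of local systems put $\sigma(V,W)=V\oplus W$, for $V,W$ on the same space, and $\tau(V_1,\dots,V_N)=p_1^*V_1\otimes\cdots\otimes p_N^*V_N$ on $X_1\times\cdots\times X_N$, for $V_i$ on $X_i$, where $p_i$ is the $i$-th projection. Proposition. Let $X_1,\dots,X_N$ be path-connected topological spaces and let $k,n\ge 0$ be integers. Then $$\Sigma^k_{1,B}(X_1\times\cdots\times X_N,n)=\bigcup_{(k_i),(n_i)}\sigma\Bigl(\tau\bigl(\Sigma^{k_1}_{1,B}(X_1,n_1)\times\cdots\times\Sigma^{k_N}_{1,B}(X_N,n_N)\bigr)\times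 M_B\bigl(X_1\times\cdots\times X_N,\;n-n_1n_2\cdots n_N\bigr)\Bigr),$$ where the union is over all $N$-tuples of non-negative integers $k_i$ with $k_1+\cdots+k_N=k$ and all $N$-tuples of positive integers $n_i$ with $n_1n_2\cdots n_N\le n$. -/

import Mathlib

open CategoryTheory CategoryTheory.Limits
open scoped TensorProduct

universe u

noncomputable section

namespace BettiLocus

/-- A complex local system on `X`: a functor from the fundamental groupoid of `X` to complex
vector spaces. If `X` is path connected, restricting to a base point `x` identifies these, up to
isomorphism, with representations of `π₁(X, x)`. -/
abbrev LocalSystem (X : Type u) [TopologicalSpace X] :=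
  FundamentalGroupoid X ⥤ ModuleCat.{0} ℂ

section Space

variable {X : Type u} [TopologicalSpace X]

/-- `V` has rank `n`: all its fibres have dimension `n`. -/
def LocalSystem.HasRank (V : LocalSystem X) (n : ℕ) : Prop :=
  ∀ x : X, Module.rank ℂ (V.obj ⟨x⟩) = (n : Cardinal)

/-- The monodromy representation of `π₁(X, x)` on the fibre of `V` at `x`. -/
def LocalSystem.monodromy (V : LocalSystem X) (x : X) :
    Representation ℂ (FundamentalGroup X x) (V.obj ⟨x⟩) :=
  ((ModuleCat.endRingEquiv (V.obj ⟨x⟩)).toMonoidHom).comp (V.mapEnd ⟨x⟩)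

/-- `V` is semisimple: its monodromy representations are. -/
def LocalSystem.IsSemisimple (V : LocalSystem X) : Prop :=
  ∀ x : X, (V.monodromy x).IsSemisimpleRepresentation

/-! ### Singular cohomology with coefficients in a local system -/

/-- The standard topological simplex with vertices `0, …, n`. -/
abbrev Simplex (n : SimplexCategory) : Type := stdSimplex ℝ (Fin (n.len + 1))

/-- The initial vertex of the standard simplex. -/
abbrev vertexZero (n : SimplexCategory) : Simplex n := stdSimplex.vertex 0

instance (n : SimplexCategory) : ContractibleSpace (Simplex n) :=
  (convex_stdSimplex ℝ (Fin (n.len + 1))).contractibleSpace ⟨_, (vertexZero n).2⟩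

instance (n : SimplexCategory) (p q : FundamentalGroupoid (Simplex n)) : Subsingleton (p ⟶ q) :=
  inferInstanceAs (Subsingleton (Path.Homotopic.Quotient p.as q.as))

/-- The only homotopy class of paths from `p` to `q` in the standard simplex. -/
def simplexPath {n : SimplexCategory} (p q : Simplex n) :
    FundamentalGroupoid.mk p ⟶ FundamentalGroupoid.mk q :=
  Path.Homotopic.Quotient.mk (PathConnectedSpace.somePath p q)

/-- The affine map of standard simplices which is `f` on vertices. -/
def simplexMap {m n : SimplexCategory} (f : m ⟶ n) : C(Simplex m, Simplex n) :=
  ⟨_, stdSimplex.continuous_map f⟩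

lemma simplexMap_id (n : SimplexCategory) :
    simplexMap (𝟙 n) = ContinuousMap.id (Simplex n) := by
  ext x : 1
  exact stdSimplex.map_id_apply x

lemma simplexMap_comp {l m n : SimplexCategory} (f : l ⟶ m) (g : m ⟶ n) :
    simplexMap (f ≫ g) = (simplexMap g).comp (simplexMap f) := by
  ext x : 1
  exact (stdSimplex.map_comp_apply f g x).symm

/-- Singular cochains of degree `n` with coefficients in `V`: functions that assign to each singular
simplex `σ` an element of the fibre of `V` at the initial vertex `σ(v₀)`. -/
abbrev SingularCochain (V : LocalSystem X) (n : SimplexCategory) : Type u :=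
  ∀ σ : C(Simplex n, X), V.obj ⟨σ (vertexZero n)⟩

/-- Transport in `V` along the image under the singular simplex `σ` of a path from `p` to `q`. -/
def LocalSystem.transport (V : LocalSystem X) {n : SimplexCategory} (σ : C(Simplex n, X))
    (p q : Simplex n) : V.obj ⟨σ p⟩ →ₗ[ℂ] V.obj ⟨σ q⟩ :=
  (V.map ((FundamentalGroupoid.map σ).map (simplexPath p q))).hom

lemma transport_self (V : LocalSystem X) {n : SimplexCategory} (σ : C(Simplex n, X))
    (p : Simplex n) (x : V.obj ⟨σ p⟩) : V.transport σ p p x = x := by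
  have e : simplexPath p p = 𝟙 (FundamentalGroupoid.mk p) := Subsingleton.elim _ _
  have e' : V.map ((FundamentalGroupoid.map σ).map (simplexPath p p)) =
      𝟙 (V.obj ((FundamentalGroupoid.map σ).obj ⟨p⟩)) := by
    rw [e, CategoryTheory.Functor.map_id, CategoryTheory.Functor.map_id]
  exact congrArg (fun φ => φ.hom x) e'

lemma transport_trans (V : LocalSystem X) {n : SimplexCategory} (σ : C(Simplex n, X))
    (p q r : Simplex n) (x : V.obj ⟨σ p⟩) :
    V.transport σ q r (V.transport σ p q x) = V.transport σ p r x := by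
  have e : simplexPath p r = simplexPath p q ≫ simplexPath q r := Subsingleton.elim _ _
  have e' : V.map ((FundamentalGroupoid.map σ).map (simplexPath p r)) =
      V.map ((FundamentalGroupoid.map σ).map (simplexPath p q)) ≫
        V.map ((FundamentalGroupoid.map σ).map (simplexPath q r)) := by
    rw [e, Functor.map_comp, Functor.map_comp]
  exact (congrArg (fun φ => φ.hom x) e').symm

lemma transport_comp (V : LocalSystem X) {m n : SimplexCategory} (σ : C(Simplex n, X))
    (a : C(Simplex m, Simplex n)) (p q : Simplex m) (x : V.obj ⟨σ (a p)⟩) :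
    V.transport (σ.comp a) p q x = V.transport σ (a p) (a q) x := by
  have e : (FundamentalGroupoid.map a).map (simplexPath p q) = simplexPath (a p) (a q) :=
    Subsingleton.elim (α := FundamentalGroupoid.mk (a p) ⟶ FundamentalGroupoid.mk (a q)) _ _
  have e' : (FundamentalGroupoid.map (σ.comp a)).map (simplexPath p q) =
      (FundamentalGroupoid.map σ).map ((FundamentalGroupoid.map a).map (simplexPath p q)) :=
    rfl
  exact congrArg (fun γ => (V.map γ).hom x)
    (e'.trans (congrArg (FundamentalGroupoid.map σ).map e))

/-- The operation of `f : [m] → [n]` on singular cochains: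
`(f c)(σ)` is `c (σ ∘ f)`, transported along `σ` from `σ(f(v₀))` to `σ(v₀)`. -/
def cochainMap (V : LocalSystem X) {m n : SimplexCategory} (f : m ⟶ n) :
    SingularCochain V m →ₗ[ℂ] SingularCochain V n where
  toFun c σ := V.transport σ (simplexMap f (vertexZero m)) (vertexZero n)
    (c (σ.comp (simplexMap f)))
  map_add' c c' := by
    funext σ
    exact map_add (V.transport σ (simplexMap f (vertexZero m)) (vertexZero n)) _ _
  map_smul' a c := by
    funext σ
    exact map_smul (V.transport σ (simplexMap f (vertexZero m)) (vertexZero n)) _ _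

lemma transport_cochain_congr (V : LocalSystem X) {m n : SimplexCategory}
    (c : SingularCochain V m) (σ : C(Simplex n, X)) {a b : C(Simplex m, Simplex n)} (h : a = b) :
    V.transport σ (a (vertexZero m)) (vertexZero n) (c (σ.comp a)) =
      V.transport σ (b (vertexZero m)) (vertexZero n) (c (σ.comp b)) := by
  subst h
  rfl

lemma cochainMap_id (V : LocalSystem X) (n : SimplexCategory) :
    cochainMap V (𝟙 n) = LinearMap.id := by
  ext c σ
  exact (transport_cochain_congr V c σ (simplexMap_id n)).trans
    (transport_self V σ (vertexZero n) (c σ))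

lemma cochainMap_comp (V : LocalSystem X) {l m n : SimplexCategory} (f : l ⟶ m) (g : m ⟶ n) :
    cochainMap V (f ≫ g) = (cochainMap V g).comp (cochainMap V f) := by
  ext c σ
  refine (transport_cochain_congr V c σ (simplexMap_comp f g)).trans ?_
  refine (transport_trans V σ _ (simplexMap g (vertexZero m)) _ _).symm.trans ?_
  exact congrArg (V.transport σ (simplexMap g (vertexZero m)) (vertexZero n))
    (transport_comp V σ (simplexMap g) (simplexMap f (vertexZero l)) (vertexZero m) _).symm

/-- The cosimplicial vector space of singular cochains with coefficients in `V`. -/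
def singularCochains (V : LocalSystem X) : CosimplicialObject (ModuleCat.{u} ℂ) where
  obj n := ModuleCat.of ℂ (SingularCochain V n)
  map f := ModuleCat.ofHom (cochainMap V f)
  map_id n := by rw [cochainMap_id]; rfl
  map_comp f g := by rw [cochainMap_comp]; rfl

/-- `H^k(X, V)`: the cohomology of the complex of singular cochains with coefficients in `V`, with
differential the alternating sum of the coface maps. -/
def cohomology (V : LocalSystem X) (k : ℕ) : ModuleCat.{u} ℂ :=
  ((AlgebraicTopology.alternatingCofaceMapComplex (ModuleCat.{u} ℂ)).obj
    (singularCochains V)).homology k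

end Space

/-! ### Isomorphism classes, moduli and cohomology support loci -/

/-- Isomorphism classes of complex local systems on `X`. -/
abbrev IsoClass (X : Type u) [TopologicalSpace X] :=
  Quotient (isIsomorphicSetoid (LocalSystem X))

/-- The isomorphism class of `V`. -/
abbrev IsoClass.mk {X : Type u} [TopologicalSpace X] (V : LocalSystem X) : IsoClass X :=
  Quotient.mk (isIsomorphicSetoid (LocalSystem X)) V

/-- The set of points of `M_B(X, n)`: isomorphism classes of semisimple local systems of
rank `n`. -/
def bettiModuli (X : Type u) [TopologicalSpace X] (n : ℕ) : Set (IsoClass X) :=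
  {c | ∃ V : LocalSystem X, c = IsoClass.mk V ∧ V.HasRank n ∧ V.IsSemisimple}

/-- `Σ^k_{m,B}(X, n)`: isomorphism classes of semisimple local systems `V` of rank `n` with
`dim H^k(X, V) ≥ m`. -/
def supportLocus (m k : ℕ) (X : Type u) [TopologicalSpace X] (n : ℕ) : Set (IsoClass X) :=
  {c | ∃ V : LocalSystem X, c = IsoClass.mk V ∧ V.HasRank n ∧ V.IsSemisimple ∧
    (m : Cardinal) ≤ Module.rank ℂ (cohomology V k)}

/-- Direct sum of isomorphism classes of local systems. -/
def directSum {X : Type u} [TopologicalSpace X] : IsoClass X → IsoClass X → IsoClass X :=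
  Quotient.map₂ (fun V W => V ⊞ W) (by
    rintro V V' ⟨e⟩ W W' ⟨e'⟩
    exact ⟨biprod.mapIso e e'⟩)

section Tensor

variable {ι : Type} {Y : Type u} [TopologicalSpace Y]

/-- The fibrewise tensor product of a family of local systems. -/
def tensorProduct (V : ι → LocalSystem Y) : LocalSystem Y where
  obj y := ModuleCat.of ℂ (⨂[ℂ] i, (V i).obj y)
  map γ := ModuleCat.ofHom (PiTensorProduct.map fun i => ((V i).map γ).hom)
  map_id y := by
    refine ModuleCat.hom_ext ?_
    refine Eq.trans ?_ (PiTensorProduct.map_id (R := ℂ) (s := fun i => (V i).obj y))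
    exact congrArg PiTensorProduct.map
      (funext fun i => congrArg ModuleCat.Hom.hom ((V i).map_id y))
  map_comp γ δ := by
    refine ModuleCat.hom_ext ?_
    refine Eq.trans ?_ (PiTensorProduct.map_comp (fun i => ((V i).map δ).hom)
      (fun i => ((V i).map γ).hom))
    simp only [ModuleCat.hom_ofHom, Functor.map_comp]
    rfl

/-- Isomorphic families have isomorphic tensor products. -/
def tensorProductIso {V W : ι → LocalSystem Y} (e : ∀ i, V i ≅ W i) :
    tensorProduct V ≅ tensorProduct W :=
  NatIso.ofComponents
    (fun y => (PiTensorProduct.congr fun i => ((e i).app y).toLinearEquiv).toModuleIso)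
    (by
      intro x y γ
      refine ModuleCat.hom_ext ?_
      refine (PiTensorProduct.map_comp (fun i => ((e i).hom.app y).hom)
        (fun i => ((V i).map γ).hom)).symm.trans ?_
      refine Eq.trans ?_ (PiTensorProduct.map_comp (fun i => ((W i).map γ).hom)
        (fun i => ((e i).hom.app x).hom))
      congr 1
      funext i
      exact congrArg ModuleCat.Hom.hom ((e i).hom.naturality γ))

end Tensor

section Product

variable {ι : Type} {X : ι → Type u} [∀ i, TopologicalSpace (X i)]

/-- The pullback `p_i^* V` along the `i`-th projection. -/
def pullbackProj (i : ι) (V : LocalSystem (X i)) : LocalSystem (∀ i, X i) :=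
  FundamentalGroupoid.map (ContinuousMap.eval i) ⋙ V

/-- The external tensor product `⨂ i, p_i^* V_i`. -/
def externalTensor (V : ∀ i, LocalSystem (X i)) : LocalSystem (∀ i, X i) :=
  tensorProduct fun i => pullbackProj i (V i)

/-- External tensor product of isomorphism classes of local systems. -/
def tensor (c : ∀ i, IsoClass (X i)) : IsoClass (∀ i, X i) :=
  IsoClass.mk (externalTensor fun i => (c i).out)

lemma tensor_mk (V : ∀ i, LocalSystem (X i)) :
    tensor (fun i => IsoClass.mk (V i)) = IsoClass.mk (externalTensor V) := by
  have h (i : ι) : Nonempty ((IsoClass.mk (V i)).out ≅ V i) :=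
    Quotient.exact (Quotient.out_eq (IsoClass.mk (V i)))
  exact Quotient.sound ⟨tensorProductIso fun i =>
    Functor.isoWhiskerLeft (FundamentalGroupoid.map (ContinuousMap.eval i)) (h i).some⟩

end Product

end BettiLocus

end

noncomputable section

namespace BettiLocus

open SimplexCategory Opposite AlgebraicTopology
open scoped Simplicial

/-! ### Exactness of cosimplicial vector spaces -/

/-! Two facts carry the proof: a Künneth criterion for non-vanishing of cohomology, and the theorem
that a finite-dimensional irreducible complex representation of a product of groups is an external
tensor product of irreducibles.

Let `V` be semisimple of finite rank with `H^k ≠ 0`. Cohomology is additive, so some irreducible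
summand `L` already has `H^k ≠ 0` (`exists_irreducible_summand`). Since `π₁` of the product is the
product of the groups `π₁`, `L` is an external tensor product of irreducible `M i`
(`exists_iso_externalTensor`), and Künneth (`not_isExactAt_externalTensor_iff`) supplies degrees
with sum `k` in which the `M i` have cohomology. The ranks of the `M i` are the `n_i`, and the
complement of `L` is the second summand. Conversely, external tensor products of semisimple systems
of finite rank are semisimple (`externalTensor_isSemisimple`), and Künneth gives the cohomology. The
statements on `N` factors follow by splitting off the first one; the empty product is a point.

Only vanishing matters, so neither an Eilenberg–Zilber map nor a dimension count is needed. A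
simplex of a product is a pair of simplices, and `E ⊗ F = Hom(E*, F)` for finite-dimensional `E`;
hence cochains of `V ⊠ W` are the cosimplicial space `n ↦ Hom(A_n, B^n)`, with `A` the chains in the
dual of `V` and `B` the cochains of `W` (`homSpaceChainSpaceIso`). Its exactness is decided by
dimension shifting in `A` (`isExactAt_homSpace_iff`): `A` is a constant space on its components plus
a reduced part, and the reduced part is the quotient of a contractible path space by a loop space.
As `Hom` over a field is exact, degree `n + 1` for the reduced part and degree `n` for the loop
space vanish together. The case where `B` is constantly one-dimensional shifts the cohomology of `A`
itself in the same way, so an induction on the degree closes.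

For representations the key is `mem_of_tensorSection`: by Burnside's theorem, a subspace of `E ⊗ F`
stable under an irreducible action on `E` has the form `E ⊗ F'`. -/

/-- A cosimplicial complex vector space. -/
abbrev CosimplicialSpace := SimplexCategory ⥤ ModuleCat.{u} ℂ

/-- A simplicial complex vector space. -/
abbrev SimplicialSpace := SimplexCategoryᵒᵖ ⥤ ModuleCat.{u} ℂ

/-- The differential of the cochain complex of a cosimplicial vector space. -/
def coboundary (M : CosimplicialSpace.{u}) (n : ℕ) : M.obj ⦋n⦌ →ₗ[ℂ] M.obj ⦋n + 1⦌ :=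
  ∑ i : Fin (n + 2), (-1 : ℤ) ^ (i : ℕ) • (M.map (SimplexCategory.δ i)).hom

lemma coboundary_apply (M : CosimplicialSpace.{u}) (n : ℕ) (x : M.obj ⦋n⦌) :
    coboundary M n x =
      ∑ i : Fin (n + 2), (-1 : ℤ) ^ (i : ℕ) • (M.map (SimplexCategory.δ i)).hom x := by
  simp only [coboundary, LinearMap.sum_apply, LinearMap.smul_apply]

lemma coboundary_eq_objD (M : CosimplicialSpace.{u}) (n : ℕ) :
    ModuleCat.ofHom (coboundary M n) = AlternatingCofaceMapComplex.objD M n := by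
  refine ModuleCat.hom_ext ?_
  unfold AlternatingCofaceMapComplex.objD
  rw [ModuleCat.hom_sum]
  rfl

lemma coboundary_coboundary (M : CosimplicialSpace.{u}) (n : ℕ) (x : M.obj ⦋n⦌) :
    coboundary M (n + 1) (coboundary M n x) = 0 := by
  have h := AlternatingCofaceMapComplex.d_squared (show CosimplicialObject _ from M) n
  rw [← coboundary_eq_objD, ← coboundary_eq_objD] at h
  exact congrArg (fun φ => φ.hom x) h

lemma coboundary_naturality {M N : CosimplicialSpace.{u}} (f : M ⟶ N) (n : ℕ)
    (x : M.obj ⦋n⦌) :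
    coboundary N n ((f.app ⦋n⦌).hom x) = (f.app ⦋n + 1⦌).hom (coboundary M n x) := by
  simp only [coboundary_apply, map_sum, map_zsmul]
  refine Finset.sum_congr rfl fun i _ => ?_
  congr 1
  exact (congrArg (fun φ => φ.hom x) (f.naturality (SimplexCategory.δ i))).symm

/-- The cochain complex of a cosimplicial vector space has no cohomology in degree `n`. -/
def IsExactAt (M : CosimplicialSpace.{u}) (n : ℕ) : Prop :=
  match n with
  | 0 => ∀ x, coboundary M 0 x = 0 → x = 0
  | n + 1 => ∀ x, coboundary M (n + 1) x = 0 → ∃ y, coboundary M n y = x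

/-- Replaces homology objects by an elementwise condition, so that all later diagram chases are with
vectors. -/
lemma isExactAt_iff_exactAt (M : CosimplicialSpace.{u}) (n : ℕ) :
    IsExactAt M n ↔ ((alternatingCofaceMapComplex _).obj M).ExactAt n := by
  have hd (m : ℕ) : ((alternatingCofaceMapComplex _).obj M).d m (m + 1) =
      ModuleCat.ofHom (coboundary M m) :=
    (CochainComplex.of_d (fun n => M.obj ⦋n⦌) (AlternatingCofaceMapComplex.objD M) m).trans
      (coboundary_eq_objD M m).symm
  cases n with
  | zero =>
    rw [HomologicalComplex.exactAt_iff' _ 0 0 1 (by simp) (by simp),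
      ShortComplex.moduleCat_exact_iff]
    -- In degree 0 the predecessor is degree 0 itself, with zero differential; exactness there means
    -- injectivity of the outgoing map.
    have h0 : ((alternatingCofaceMapComplex _).obj M).d 0 0 = 0 :=
      HomologicalComplex.shape _ _ _ (by simp)
    refine forall_congr' fun x => imp_congr ?_ ?_
    · exact (congrArg (fun φ => φ.hom x = 0) (hd 0).symm).to_iff
    · constructor
      · rintro rfl
        exact ⟨0, map_zero _⟩
      · rintro ⟨y, rfl⟩
        exact congrArg (fun φ => φ.hom y) h0
  | succ n =>
    rw [HomologicalComplex.exactAt_iff' _ n (n + 1) (n + 2) (by simp) (by simp),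
      ShortComplex.moduleCat_exact_iff]
    refine forall_congr' fun x => imp_congr ?_ (exists_congr fun y => ?_)
    · exact (congrArg (fun φ => φ.hom x = 0) (hd (n + 1)).symm).to_iff
    · exact (congrArg (fun φ => φ.hom y = x) (hd n).symm).to_iff

/-- The cosimplicial vector space of singular cochains, as a functor. -/
def cochainSpace {X : Type u} [TopologicalSpace X] (V : LocalSystem X) : CosimplicialSpace.{u} :=
  singularCochains V

lemma one_le_rank_cohomology_iff {X : Type u} [TopologicalSpace X] (V : LocalSystem X) (k : ℕ) :
    ((1 : ℕ) : Cardinal) ≤ Module.rank ℂ (cohomology V k) ↔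
      ¬ IsExactAt (cochainSpace V) k := by
  rw [isExactAt_iff_exactAt, HomologicalComplex.exactAt_iff_isZero_homology,
    ModuleCat.isZero_iff_subsingleton, not_subsingleton_iff_nontrivial, Nat.cast_one,
    Cardinal.one_le_iff_pos, rank_pos_iff_nontrivial]
  rfl

lemma IsExactAt.of_retract {M N : CosimplicialSpace.{u}} (i : M ⟶ N) (r : N ⟶ M)
    (h : i ≫ r = 𝟙 M) {n : ℕ} (hN : IsExactAt N n) : IsExactAt M n := by
  have hir (m : SimplexCategory) (x : M.obj m) : (r.app m).hom ((i.app m).hom x) = x :=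
    congrArg (fun φ => (φ.app m).hom x) h
  cases n with
  | zero =>
    intro x hx
    have h0 : (i.app _).hom x = 0 := hN _ (by rw [coboundary_naturality, hx, map_zero])
    rw [← hir _ x, h0, map_zero]
  | succ n =>
    intro x hx
    obtain ⟨y, hy⟩ := hN ((i.app _).hom x) (by rw [coboundary_naturality, hx, map_zero])
    exact ⟨(r.app _).hom y, by rw [coboundary_naturality, hy, hir]⟩

lemma isExactAt_congr {M N : CosimplicialSpace.{u}} (e : M ≅ N) (n : ℕ) :
    IsExactAt M n ↔ IsExactAt N n :=
  ⟨.of_retract e.inv e.hom e.inv_hom_id, .of_retract e.hom e.inv e.hom_inv_id⟩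

/-- Additivity of cohomology, phrased by inclusions and retractions. It serves both for direct sums
of local systems and for splitting the components off a simplicial space. -/
lemma isExactAt_iff_of_binary {M M₁ M₂ : CosimplicialSpace.{u}}
    (i₁ : M₁ ⟶ M) (r₁ : M ⟶ M₁) (i₂ : M₂ ⟶ M) (r₂ : M ⟶ M₂) (h₁ : i₁ ≫ r₁ = 𝟙 M₁)
    (h₂ : i₂ ≫ r₂ = 𝟙 M₂)
    (h : ∀ m (x : M.obj m), (i₁.app m).hom ((r₁.app m).hom x) +
      (i₂.app m).hom ((r₂.app m).hom x) = x) (n : ℕ) :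
    IsExactAt M n ↔ IsExactAt M₁ n ∧ IsExactAt M₂ n := by
  refine ⟨fun H => ⟨H.of_retract _ _ h₁, H.of_retract _ _ h₂⟩, fun ⟨H₁, H₂⟩ => ?_⟩
  cases n with
  | zero =>
    intro x hx
    have h₁ : (r₁.app _).hom x = 0 := H₁ _ (by rw [coboundary_naturality, hx, map_zero])
    have h₂ : (r₂.app _).hom x = 0 := H₂ _ (by rw [coboundary_naturality, hx, map_zero])
    rw [← h _ x, h₁, h₂, map_zero, map_zero, add_zero]
  | succ n =>
    intro x hx
    obtain ⟨y₁, hy₁⟩ := H₁ ((r₁.app _).hom x) (by rw [coboundary_naturality, hx, map_zero])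
    obtain ⟨y₂, hy₂⟩ := H₂ ((r₂.app _).hom x) (by rw [coboundary_naturality, hx, map_zero])
    exact ⟨(i₁.app _).hom y₁ + (i₂.app _).hom y₂, by
      rw [map_add, coboundary_naturality, coboundary_naturality, hy₁, hy₂, h]⟩

/-! ### Dimension shifting along short exact sequences with exact middle term -/

section ShortExact

variable {M₁ M₂ M₃ : CosimplicialSpace.{u}} (f : M₁ ⟶ M₂) (g : M₂ ⟶ M₃)
  (hf : ∀ m, Function.Injective (f.app m).hom) (hg : ∀ m, Function.Surjective (g.app m).hom)
  (hfg : ∀ m (x : M₂.obj m), (g.app m).hom x = 0 ↔ ∃ y, (f.app m).hom y = x)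
  (h : ∀ n, IsExactAt M₂ n)

include hf h in
lemma isExactAt_zero_of_shortExact : IsExactAt M₁ 0 := by
  intro x hx
  refine hf _ ?_
  rw [map_zero]
  exact h 0 _ (by rw [coboundary_naturality, hx, map_zero])

include hf hg hfg h in
-- With `M₂` exact, the connecting map from degree `n` of `M₃` to degree `n + 1` of `M₁` is an
-- isomorphism; this is its chase, reduced to vanishing.
lemma isExactAt_succ_iff_of_shortExact (n : ℕ) : IsExactAt M₁ (n + 1) ↔ IsExactAt M₃ n := by
  have hgf (m) (y : M₁.obj m) : (g.app m).hom ((f.app m).hom y) = 0 := (hfg m _).2 ⟨y, rfl⟩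
  constructor
  · intro H
    -- A cocycle of `M₃` lifts to a cocycle of `M₂`: the coboundary of any lift is a cocycle of
    -- `M₁`, hence a coboundary there, and the lift is corrected by it.
    have key (z : M₃.obj ⦋n⦌) (hz : coboundary M₃ n z = 0) :
        ∃ y : M₂.obj ⦋n⦌, coboundary M₂ n y = 0 ∧ (g.app _).hom y = z := by
      obtain ⟨y, rfl⟩ := hg _ z
      rw [coboundary_naturality, hfg] at hz
      obtain ⟨x, hx⟩ := hz
      have hx' : coboundary M₁ (n + 1) x = 0 := by
        refine hf _ ?_
        rw [← coboundary_naturality, hx, coboundary_coboundary, map_zero]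
      obtain ⟨w, rfl⟩ := H x hx'
      exact ⟨y - (f.app _).hom w, by rw [map_sub, coboundary_naturality, hx, sub_self],
        by rw [map_sub, hgf, sub_zero]⟩
    cases n with
    | zero =>
      intro z hz
      obtain ⟨y, hy, rfl⟩ := key z hz
      rw [h 0 y hy, map_zero]
    | succ n =>
      intro z hz
      obtain ⟨y, hy, rfl⟩ := key z hz
      obtain ⟨w, rfl⟩ := h (n + 1) y hy
      exact ⟨(g.app _).hom w, coboundary_naturality g n w⟩
  · intro H x hx
    obtain ⟨y, hy⟩ := h (n + 1) ((f.app _).hom x) (by rw [coboundary_naturality, hx, map_zero])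
    have hy' : coboundary M₃ n ((g.app _).hom y) = 0 := by
      rw [coboundary_naturality, hy, hgf]
    have key : ∃ y' : M₂.obj ⦋n⦌, coboundary M₂ n y' = 0 ∧ (g.app _).hom y' = (g.app _).hom y := by
      cases n with
      | zero => exact ⟨0, map_zero _, by rw [map_zero]; exact (H _ hy').symm⟩
      | succ n =>
        obtain ⟨z, hz⟩ := H _ hy'
        obtain ⟨w, rfl⟩ := hg _ z
        exact ⟨coboundary M₂ n w, coboundary_coboundary _ _ _, by
          rw [← coboundary_naturality, hz]⟩
    obtain ⟨y', h0, h1⟩ := key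
    obtain ⟨w, hw⟩ := (hfg _ (y - y')).1 (by rw [map_sub, h1, sub_self])
    refine ⟨w, hf _ ?_⟩
    rw [← coboundary_naturality, hw, map_sub, h0, sub_zero, hy]

end ShortExact

/-! ### The cosimplicial space of linear maps -/

/-- The cosimplicial space `n ↦ Hom(A_n, B^n)`. -/
def homSpace (A : SimplicialSpace.{u}) (B : CosimplicialSpace.{u}) : CosimplicialSpace.{u} where
  obj n := ModuleCat.of ℂ (A.obj (op n) →ₗ[ℂ] B.obj n)
  map f := ModuleCat.ofHom
    { toFun := fun u => (B.map f).hom ∘ₗ u ∘ₗ (A.map f.op).hom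
      map_add' := fun u v => by ext; simp
      map_smul' := fun c u => by ext; simp }
  map_id n := by
    refine ModuleCat.hom_ext (LinearMap.ext fun u => LinearMap.ext fun a => ?_)
    simp
  map_comp f g := by
    refine ModuleCat.hom_ext (LinearMap.ext fun u => LinearMap.ext fun a => ?_)
    simp

/-- Precomposition with a map of simplicial spaces. -/
def homSpaceMap {A A' : SimplicialSpace.{u}} (f : A ⟶ A') (B : CosimplicialSpace.{u}) :
    homSpace A' B ⟶ homSpace A B where
  app n := ModuleCat.ofHom
    { toFun := fun u => u ∘ₗ (f.app (op n)).hom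
      map_add' := fun u v => by ext; simp
      map_smul' := fun c u => by ext; simp }
  naturality m n g := by
    refine ModuleCat.hom_ext (LinearMap.ext fun u => LinearMap.ext fun a => ?_)
    exact congrArg (fun x => (B.map g).hom ((show A'.obj (op m) →ₗ[ℂ] B.obj m from u) x))
      (congrArg (fun φ => φ.hom a) (f.naturality g.op)).symm

lemma homSpaceMap_apply {A A' : SimplicialSpace.{u}} (f : A ⟶ A') (B : CosimplicialSpace.{u})
    (n : SimplexCategory) (u : A'.obj (op n) →ₗ[ℂ] B.obj n) :
    ((homSpaceMap f B).app n).hom u = u ∘ₗ (f.app (op n)).hom := rfl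

/-- A cosimplicial object is a simplicial object of the opposite category, so a simplicial homotopy
there gives a chain homotopy; read backwards, it contracts the cochain complex of `M`. -/
lemma isExactAt_of_homotopy (M : CosimplicialSpace.{u})
    {f : (show SimplicialObject (ModuleCat.{u} ℂ)ᵒᵖ from M.op) ⟶ M.op}
    (hf : ∀ n, f.app n = 0)
    (H : SimplicialObject.Homotopy f (𝟙 (show SimplicialObject (ModuleCat.{u} ℂ)ᵒᵖ from M.op)))
    (n : ℕ) : IsExactAt M n := by
  have hd (n : ℕ) : (((alternatingFaceMapComplex (ModuleCat.{u} ℂ)ᵒᵖ).obj M.op).d (n + 1) n) =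
      (ModuleCat.ofHom (coboundary M n)).op := by
    refine (AlternatingFaceMapComplex.obj_d_eq _ _).trans ?_
    rw [coboundary_eq_objD]
    unfold AlternatingCofaceMapComplex.objD
    rw [op_sum]
    rfl
  have h := H.toChainHomotopy.comm n
  have hf' : ((alternatingFaceMapComplex (ModuleCat.{u} ℂ)ᵒᵖ).map f).f n = 0 := hf _
  have hid : ((alternatingFaceMapComplex (ModuleCat.{u} ℂ)ᵒᵖ).map
      (𝟙 (show SimplicialObject (ModuleCat.{u} ℂ)ᵒᵖ from M.op))).f n = 𝟙 (op (M.obj ⦋n⦌)) := rfl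
  rw [hf', hid, prevD_eq _ (show (ComplexShape.down ℕ).Rel (n + 1) n from rfl), hd] at h
  cases n with
  | zero =>
    rw [dNext_eq_zero _ _ (by simp), zero_add] at h
    intro x hx
    let k : M.obj ⦋1⦌ →ₗ[ℂ] M.obj ⦋0⦌ := (H.toChainHomotopy.hom 0 1).unop.hom
    have h' : 0 = k (coboundary M 0 x) + x :=
      congrArg (fun φ => φ.unop.hom x) h
    rw [hx, map_zero, zero_add] at h'
    exact h'.symm
  | succ n =>
    rw [dNext_eq _ (show (ComplexShape.down ℕ).Rel (n + 1) n from rfl), hd] at h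
    intro x hx
    let k : M.obj ⦋n + 1⦌ →ₗ[ℂ] M.obj ⦋n⦌ := (H.toChainHomotopy.hom n (n + 1)).unop.hom
    let k' : M.obj ⦋n + 2⦌ →ₗ[ℂ] M.obj ⦋n + 1⦌ :=
      (H.toChainHomotopy.hom (n + 1) (n + 2)).unop.hom
    have h' : 0 = coboundary M n (k x) + k' (coboundary M (n + 1) x) + x :=
      congrArg (fun φ => φ.unop.hom x) h
    rw [hx, map_zero, add_zero] at h'
    exact ⟨-k x, by rw [map_neg]; exact (eq_neg_of_add_eq_zero_right h'.symm).symm⟩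

/-- A simplicial homotopy on `A` from `f` to the identity induces one on `homSpace A B`. -/
def homSpaceHomotopy {A : SimplicialSpace.{u}} {f : A ⟶ A}
    (H : SimplicialObject.Homotopy (X := A) (Y := A) f (𝟙 A)) (B : CosimplicialSpace.{u}) :
    SimplicialObject.Homotopy (X := (homSpace A B).op) (Y := (homSpace A B).op)
      (NatTrans.op (homSpaceMap f B)) (𝟙 _) where
  -- The homotopy operator raises the degree in `A`, so the degree in `B` must be lowered to match:
  -- the codegeneracy `σ i` does it. Each identity below is then the homotopy identity in `A` (`e₁`)
  -- combined with a cosimplicial identity in `B` (`e₂`, and `e₃` where present).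
  h {n} i := Quiver.Hom.op (X := (homSpace A B).obj ⦋n + 1⦌) (Y := (homSpace A B).obj ⦋n⦌)
    (ModuleCat.ofHom
      { toFun := fun u => (B.map (SimplexCategory.σ i)).hom ∘ₗ u ∘ₗ (H.h i).hom
        map_add' := fun u v => by ext; simp
        map_smul' := fun c u => by ext; simp })
  h_zero_comp_δ_zero n := by
    apply Quiver.Hom.unop_inj
    refine ModuleCat.hom_ext (LinearMap.ext fun (u : A.obj (op ⦋n⦌) →ₗ[ℂ]
      B.obj ⦋n⦌) => LinearMap.ext fun a => ?_)
    have e₁ :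
        (A.map (SimplexCategory.δ 0).op).hom ((H.h 0).hom a) = a :=
      congrArg (fun φ => φ.hom a) (H.h_zero_comp_δ_zero n)
    have e₂ (y : B.obj ⦋n⦌) :
        (B.map (SimplexCategory.σ 0)).hom ((B.map (SimplexCategory.δ 0)).hom y) = y :=
      congrArg (fun φ => φ.hom y)
        (CosimplicialObject.δ_comp_σ_self (X := B) (i := (0 : Fin (n + 1))))
    exact (congrArg (fun y => (B.map _).hom ((B.map _).hom (u y))) e₁).trans (e₂ _)
  h_last_comp_δ_last n := by
    apply Quiver.Hom.unop_inj
    refine ModuleCat.hom_ext (LinearMap.ext fun (u : A.obj (op ⦋n⦌) →ₗ[ℂ]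
      B.obj ⦋n⦌) => LinearMap.ext fun a => ?_)
    have e₁ :
        (A.map (SimplexCategory.δ (Fin.last (n + 1))).op).hom ((H.h (Fin.last n)).hom a) =
          (f.app (op ⦋n⦌)).hom a :=
      congrArg (fun φ => φ.hom a) (H.h_last_comp_δ_last n)
    have e₂ (y : B.obj ⦋n⦌) :
        (B.map (SimplexCategory.σ (Fin.last n))).hom
          ((B.map (SimplexCategory.δ (Fin.last (n + 1)))).hom y) = y :=
      congrArg (fun φ => φ.hom y) (CosimplicialObject.δ_comp_σ_succ (X := B) (i := Fin.last n))
    exact (congrArg (fun y => (B.map _).hom ((B.map _).hom (u y))) e₁).trans (e₂ _)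
  h_succ_comp_δ_castSucc_of_lt {n} i j hij := by
    apply Quiver.Hom.unop_inj
    refine ModuleCat.hom_ext (LinearMap.ext fun (u : A.obj (op ⦋n + 1⦌) →ₗ[ℂ]
      B.obj ⦋n + 1⦌) => LinearMap.ext fun a => ?_)
    have e₁ :
        (A.map (SimplexCategory.δ i.castSucc).op).hom ((H.h j.succ).hom a) =
          (H.h j).hom ((A.map (SimplexCategory.δ i).op).hom a) :=
      congrArg (fun φ => φ.hom a) (H.h_succ_comp_δ_castSucc_of_lt i j hij)
    have e₂ (y : B.obj ⦋n + 1⦌) :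
        (B.map (SimplexCategory.σ j.succ)).hom ((B.map (SimplexCategory.δ i.castSucc)).hom y) =
          (B.map (SimplexCategory.δ i)).hom ((B.map (SimplexCategory.σ j)).hom y) :=
      congrArg (fun φ => φ.hom y) (CosimplicialObject.δ_comp_σ_of_le (X := B) hij)
    exact (congrArg (fun y => (B.map _).hom ((B.map _).hom (u y))) e₁).trans (e₂ _)
  h_succ_comp_δ_castSucc_succ {n} j := by
    apply Quiver.Hom.unop_inj
    refine ModuleCat.hom_ext (LinearMap.ext fun (u : A.obj (op ⦋n + 1⦌) →ₗ[ℂ]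
      B.obj ⦋n + 1⦌) => LinearMap.ext fun a => ?_)
    have e₁ : (A.map (SimplexCategory.δ j.castSucc.succ).op).hom ((H.h j.succ).hom a) =
        (A.map (SimplexCategory.δ j.castSucc.succ).op).hom ((H.h j.castSucc).hom a) :=
      congrArg (fun φ => φ.hom a) (H.h_succ_comp_δ_castSucc_succ j)
    have e₂ (y : B.obj ⦋n + 1⦌) : (B.map (SimplexCategory.σ j.succ)).hom
        ((B.map (SimplexCategory.δ j.castSucc.succ)).hom y) = y :=
      congrArg (fun φ => φ.hom y) (CosimplicialObject.δ_comp_σ_self (X := B) (i := j.succ))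
    have e₃ (y : B.obj ⦋n + 1⦌) : (B.map (SimplexCategory.σ j.castSucc)).hom
        ((B.map (SimplexCategory.δ j.castSucc.succ)).hom y) = y :=
      congrArg (fun φ => φ.hom y) (CosimplicialObject.δ_comp_σ_succ (X := B) (i := j.castSucc))
    exact ((e₂ _).trans (congrArg u e₁)).trans (e₃ _).symm
  h_castSucc_comp_δ_succ_of_lt {n} i j hji := by
    apply Quiver.Hom.unop_inj
    refine ModuleCat.hom_ext (LinearMap.ext fun (u : A.obj (op ⦋n + 1⦌) →ₗ[ℂ]
      B.obj ⦋n + 1⦌) => LinearMap.ext fun a => ?_)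
    have e₁ :
        (A.map (SimplexCategory.δ i.succ).op).hom ((H.h j.castSucc).hom a) =
          (H.h j).hom ((A.map (SimplexCategory.δ i).op).hom a) :=
      congrArg (fun φ => φ.hom a) (H.h_castSucc_comp_δ_succ_of_lt i j hji)
    have e₂ (y : B.obj ⦋n + 1⦌) :
        (B.map (SimplexCategory.σ j.castSucc)).hom ((B.map (SimplexCategory.δ i.succ)).hom y) =
          (B.map (SimplexCategory.δ i)).hom ((B.map (SimplexCategory.σ j)).hom y) :=
      congrArg (fun φ => φ.hom y) (CosimplicialObject.δ_comp_σ_of_gt (X := B) hji)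
    exact (congrArg (fun y => (B.map _).hom ((B.map _).hom (u y))) e₁).trans (e₂ _)
  h_comp_σ_castSucc_of_le {n} i j hij := by
    apply Quiver.Hom.unop_inj
    refine ModuleCat.hom_ext (LinearMap.ext fun (u : A.obj (op ⦋n + 1 + 1⦌) →ₗ[ℂ]
      B.obj ⦋n + 1 + 1⦌) => LinearMap.ext fun a => ?_)
    have e₁ :
        (A.map (SimplexCategory.σ i.castSucc).op).hom ((H.h j).hom a) =
          (H.h j.succ).hom ((A.map (SimplexCategory.σ i).op).hom a) :=
      congrArg (fun φ => φ.hom a) (H.h_comp_σ_castSucc_of_le i j hij)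
    have e₂ (y : B.obj ⦋n + 1 + 1⦌) :
        (B.map (SimplexCategory.σ j)).hom ((B.map (SimplexCategory.σ i.castSucc)).hom y) =
          (B.map (SimplexCategory.σ i)).hom ((B.map (SimplexCategory.σ j.succ)).hom y) :=
      congrArg (fun φ => φ.hom y) (CosimplicialObject.σ_comp_σ (X := B) hij)
    exact (congrArg (fun y => (B.map _).hom ((B.map _).hom (u y))) e₁).trans (e₂ _)
  h_comp_σ_succ_of_lt {n} i j hji := by
    apply Quiver.Hom.unop_inj
    refine ModuleCat.hom_ext (LinearMap.ext fun (u : A.obj (op ⦋n + 1 + 1⦌) →ₗ[ℂ]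
      B.obj ⦋n + 1 + 1⦌) => LinearMap.ext fun a => ?_)
    have e₁ :
        (A.map (SimplexCategory.σ i.succ).op).hom ((H.h j).hom a) =
          (H.h j.castSucc).hom ((A.map (SimplexCategory.σ i).op).hom a) :=
      congrArg (fun φ => φ.hom a) (H.h_comp_σ_succ_of_lt i j hji)
    have e₂ (y : B.obj ⦋n + 1 + 1⦌) :
        (B.map (SimplexCategory.σ j)).hom ((B.map (SimplexCategory.σ i.succ)).hom y) =
          (B.map (SimplexCategory.σ i)).hom ((B.map (SimplexCategory.σ j.castSucc)).hom y) :=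
      congrArg (fun φ => φ.hom y) ((CosimplicialObject.σ_comp_σ (X := B) hji).symm)
    exact (congrArg (fun y => (B.map _).hom ((B.map _).hom (u y))) e₁).trans (e₂ _)

lemma isExactAt_homSpace_of_homotopy {A : SimplicialSpace.{u}} {f : A ⟶ A}
    (hf : ∀ n, f.app n = 0) (H : SimplicialObject.Homotopy (X := A) (Y := A) f (𝟙 A))
    (B : CosimplicialSpace.{u}) (n : ℕ) : IsExactAt (homSpace A B) n := by
  refine isExactAt_of_homotopy _ (fun m => ?_) (homSpaceHomotopy H B) n
  apply Quiver.Hom.unop_inj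
  refine ModuleCat.hom_ext (LinearMap.ext fun (u : A.obj m →ₗ[ℂ]
      B.obj m.unop) => LinearMap.ext fun a => ?_)
  refine (congrArg (fun φ => u (φ.hom a)) (hf _)).trans ?_
  exact map_zero u

/-! ### Constant spaces -/

/-- All coface maps agree, and each is invertible, so their alternating sum is alternately zero and
an isomorphism. Used for constant spaces and for a one-point space. -/
lemma isExactAt_of_thin (M : CosimplicialSpace.{u})
    (hM : ∀ {m n : SimplexCategory} (f g : m ⟶ n), M.map f = M.map g) (n : ℕ) :
    IsExactAt M n ↔ n ≠ 0 ∨ Subsingleton (M.obj ⦋0⦌) := by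
  -- There are `n + 2` signs, so they cancel exactly when `n` is even.
  have hsum (n : ℕ) : ∑ i : Fin (n + 2), (-1 : ℤ) ^ (i : ℕ) = if Even n then 0 else 1 := by
    rw [Fin.sum_univ_eq_sum_range (fun i => (-1 : ℤ) ^ i) (n + 2), neg_one_geom_sum]
    simp [Nat.even_add_one]
  have hd (n : ℕ) (x : M.obj ⦋n⦌) : coboundary M n x =
      (if Even n then 0 else 1 : ℤ) • (M.map (SimplexCategory.δ 0)).hom x := by
    rw [coboundary_apply, ← hsum, Finset.sum_smul]
    exact Finset.sum_congr rfl fun i _ => by rw [hM (SimplexCategory.δ i) (SimplexCategory.δ 0)]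
  have hσδ (n : ℕ) (x : M.obj ⦋n⦌) : (M.map (SimplexCategory.σ 0)).hom
      ((M.map (SimplexCategory.δ (0 : Fin (n + 2)))).hom x) = x := by
    have h := congrArg M.map (SimplexCategory.δ_comp_σ_self (i := (0 : Fin (n + 1))))
    rw [M.map_comp, M.map_id] at h
    exact congrArg (fun φ => φ.hom x) h
  have hδσ (n : ℕ) (x : M.obj ⦋n + 1⦌) : (M.map (SimplexCategory.δ (0 : Fin (n + 2)))).hom
      ((M.map (SimplexCategory.σ 0)).hom x) = x := by
    have h := hM (SimplexCategory.σ (0 : Fin (n + 1)) ≫ SimplexCategory.δ 0) (𝟙 _)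
    rw [M.map_comp, M.map_id] at h
    exact congrArg (fun φ => φ.hom x) h
  cases n with
  | zero =>
    simp only [ne_eq, not_true_eq_false, false_or]
    exact ⟨fun h => subsingleton_of_forall_eq 0 fun x => h x (by rw [hd]; simp),
      fun h x _ => Subsingleton.elim _ _⟩
  | succ n =>
    simp only [ne_eq, Nat.add_eq_zero_iff, one_ne_zero, and_false, not_false_eq_true, true_or,
      iff_true]
    intro x hx
    by_cases h : Even n
    · rw [hd, if_neg (by simpa [Nat.even_add_one] using h), one_smul] at hx
      exact ⟨0, by rw [map_zero, ← hσδ _ x, hx, map_zero]⟩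
    · exact ⟨(M.map (SimplexCategory.σ 0)).hom x, by rw [hd, if_neg h, one_smul, hδσ]⟩

/-- The cosimplicial space that is constantly one-dimensional. -/
def unitSpace : CosimplicialSpace.{u} :=
  (Functor.const _).obj (ModuleCat.of ℂ (ULift.{u} ℂ))

lemma isExactAt_unitSpace_iff (n : ℕ) : IsExactAt unitSpace.{u} n ↔ n ≠ 0 := by
  rw [isExactAt_of_thin _ fun _ _ => rfl, or_iff_left]
  rw [not_subsingleton_iff_nontrivial]
  exact inferInstanceAs (Nontrivial (ULift.{u} ℂ))

/-- The constant simplicial space. -/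
abbrev constSpace (W : Type u) [AddCommGroup W] [Module ℂ W] : SimplicialSpace.{u} :=
  (Functor.const _).obj (ModuleCat.of ℂ W)

section Const

variable (W : Type u) [AddCommGroup W] [Module ℂ W] (B : CosimplicialSpace.{u})

lemma coboundary_homSpace_constSpace (n : ℕ) (u : W →ₗ[ℂ] B.obj ⦋n⦌) :
    coboundary (homSpace (constSpace W) B) n u = coboundary B n ∘ₗ u := by
  refine (coboundary_apply (homSpace (constSpace W) B) n u).trans (LinearMap.ext fun w => ?_)
  rw [LinearMap.comp_apply, coboundary_apply]
  exact LinearMap.sum_apply _ _ _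

/-- `Hom(W, -)` preserves exactness because vector spaces are projective. Conversely, for `W ≠ 0`, a
vector `w` and a functional with `l w = 1` make `B` a retract of `Hom(W, B)`. -/
lemma isExactAt_homSpace_constSpace_iff (n : ℕ) :
    IsExactAt (homSpace (constSpace W) B) n ↔ Subsingleton W ∨ IsExactAt B n := by
  constructor
  · intro h
    by_cases hW : Subsingleton W
    · exact Or.inl hW
    right
    rw [not_subsingleton_iff_nontrivial] at hW
    obtain ⟨w, hw⟩ := exists_ne (0 : W)
    obtain ⟨l, hl⟩ := Module.Projective.exists_dual_eq_one ℂ hw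
    let ι : B ⟶ homSpace (constSpace W) B :=
      { app := fun m => ModuleCat.ofHom
          { toFun := fun b => l.smulRight b
            map_add' := fun b c => by ext; simp
            map_smul' := fun c b => LinearMap.ext fun x => smul_comm (l x) c b }
        naturality := fun m m' f => by
          refine ModuleCat.hom_ext (LinearMap.ext fun b => LinearMap.ext fun x => ?_)
          exact (map_smul (B.map f).hom (l x) b).symm }
    let ρ : homSpace (constSpace W) B ⟶ B :=
      { app := fun m => ModuleCat.ofHom (LinearMap.applyₗ (R := ℂ) (M := W) (M₂ := B.obj m) w)
        naturality := fun m m' f => rfl }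
    refine h.of_retract ι ρ (NatTrans.ext (funext fun m => ModuleCat.hom_ext
      (LinearMap.ext fun b => ?_)))
    refine (congrArg (· • b) hl).trans (one_smul ℂ b)
  · rintro (h | h)
    · have (m : ℕ) : Subsingleton ((homSpace (constSpace W) B).obj ⦋m⦌) :=
        inferInstanceAs (Subsingleton (W →ₗ[ℂ] B.obj ⦋m⦌))
      cases n with
      | zero => exact fun x _ => Subsingleton.elim _ _
      | succ n => exact fun x _ => ⟨0, Subsingleton.elim _ _⟩
    · cases n with
      | zero =>
        intro (u : W →ₗ[ℂ] B.obj ⦋0⦌) hu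
        rw [coboundary_homSpace_constSpace] at hu
        exact LinearMap.ext fun w => h _ (LinearMap.congr_fun hu w)
      | succ n =>
        intro (u : W →ₗ[ℂ] B.obj ⦋n + 1⦌) hu
        rw [coboundary_homSpace_constSpace] at hu
        have hu' : ∀ w, u w ∈ LinearMap.range (coboundary B n) := fun w =>
          h _ (LinearMap.congr_fun hu w)
        obtain ⟨v, hv⟩ := Module.projective_lifting_property (coboundary B n).rangeRestrict
          (u.codRestrict _ hu') (coboundary B n).surjective_rangeRestrict
        refine ⟨v, (coboundary_homSpace_constSpace W B n v).trans (LinearMap.ext fun w => ?_)⟩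
        exact congrArg Subtype.val (LinearMap.congr_fun hv w)

end Const

/-! ### Short exact sequences of simplicial spaces -/

section ShortExact

variable {A₁ A₂ A₃ : SimplicialSpace.{u}} (i : A₁ ⟶ A₂) (p : A₂ ⟶ A₃)
  (hi : ∀ n, Function.Injective (i.app n).hom) (hp : ∀ n, Function.Surjective (p.app n).hom)
  (hip : ∀ n (x : A₂.obj n), (p.app n).hom x = 0 ↔ ∃ y, (i.app n).hom y = x)
  (B : CosimplicialSpace.{u})

include hp in
lemma homSpaceMap_injective (n : SimplexCategory) :
    Function.Injective ((homSpaceMap p B).app n).hom := by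
  intro (u : A₃.obj (op n) →ₗ[ℂ] B.obj n) (v : A₃.obj (op n) →ₗ[ℂ] B.obj n) h
  rw [homSpaceMap_apply, homSpaceMap_apply] at h
  exact (LinearMap.cancel_right (hp _)).1 h

include hi in
lemma homSpaceMap_surjective (n : SimplexCategory) :
    Function.Surjective ((homSpaceMap i B).app n).hom := by
  intro (u : A₁.obj (op n) →ₗ[ℂ] B.obj n)
  obtain ⟨r, hr⟩ := (i.app (op n)).hom.exists_leftInverse_of_injective
    (LinearMap.ker_eq_bot.2 (hi _))
  exact ⟨u ∘ₗ r, by rw [homSpaceMap_apply, LinearMap.comp_assoc, hr, LinearMap.comp_id]⟩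

include hp hip in
-- A linear section of `p` exists in each degree, and that suffices: exactness is only asked
-- degreewise, so the section need not be simplicial.
lemma homSpaceMap_exact (n : SimplexCategory) (u : (homSpace A₂ B).obj n) :
    ((homSpaceMap i B).app n).hom u = 0 ↔ ∃ v, ((homSpaceMap p B).app n).hom v = u := by
  change A₂.obj (op n) →ₗ[ℂ] B.obj n at u
  rw [homSpaceMap_apply]
  constructor
  · intro h
    obtain ⟨s, hs⟩ := (p.app (op n)).hom.exists_rightInverse_of_surjective
      (LinearMap.range_eq_top.2 (hp _))
    refine ⟨u ∘ₗ s, ?_⟩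
    rw [homSpaceMap_apply]
    refine LinearMap.ext fun x => ?_
    obtain ⟨y, hy⟩ := (hip (op n) (s ((p.app (op n)).hom x) - x)).1 (by
      rw [map_sub, sub_eq_zero]; exact LinearMap.congr_fun hs _)
    have h' : u (s ((p.app (op n)).hom x) - x) = 0 := by
      rw [← hy]; exact LinearMap.congr_fun h y
    rw [map_sub, sub_eq_zero] at h'
    exact h'
  · rintro ⟨v, rfl⟩
    change A₃.obj (op n) →ₗ[ℂ] B.obj n at v
    refine LinearMap.ext fun y => ?_
    have h : (p.app (op n)).hom ((i.app (op n)).hom y) = 0 := (hip _ _).2 ⟨y, rfl⟩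
    exact (congrArg v h).trans (map_zero v)

end ShortExact

/-! ### The path object of a simplicial space -/

/-- Comparing values as natural numbers turns the simplicial identities for cones into arithmetic.
-/
lemma simplexHom_ext {m n : SimplexCategory} {f g : m ⟶ n}
    (h : ∀ k, (f.toOrderHom k : ℕ) = g.toOrderHom k) : f = g :=
  SimplexCategory.Hom.ext _ _ (OrderHom.ext _ _ (funext fun k => Fin.ext (h k)))

lemma δ_val {n : ℕ} (i : Fin (n + 2)) (k : Fin (n + 1)) :
    ((SimplexCategory.δ i).toOrderHom k : ℕ) = if (k : ℕ) < i then (k : ℕ) else k + 1 := by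
  change (i.succAbove k : ℕ) = _
  rw [Fin.succAbove]
  simp only [Fin.lt_def, Fin.val_castSucc]
  split_ifs <;> rfl

lemma σ_val {n : ℕ} (i : Fin (n + 1)) (k : Fin (n + 2)) :
    ((SimplexCategory.σ i).toOrderHom k : ℕ) = if (i : ℕ) < k then (k : ℕ) - 1 else k := by
  change (i.predAbove k : ℕ) = _
  rw [Fin.predAbove]
  simp only [Fin.lt_def, Fin.val_castSucc]
  split_ifs <;> rfl

/-- The extension of `f : m ⟶ n` to the cones, i.e. the simplices with one more initial vertex. -/
def coneMap {m n : SimplexCategory} (f : m ⟶ n) : ⦋m.len + 1⦌ ⟶ ⦋n.len + 1⦌ :=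
  SimplexCategory.Hom.mk ⟨Fin.cases 0 fun j => (f.toOrderHom j).succ, by
    intro a b h
    cases a using Fin.cases with
    | zero => exact Fin.zero_le _
    | succ a =>
      cases b using Fin.cases with
      | zero => exact absurd h (by simp)
      | succ b => exact Fin.succ_le_succ_iff.2 (f.toOrderHom.monotone (Fin.succ_le_succ_iff.1 h))⟩

lemma coneMap_zero {m n : SimplexCategory} (f : m ⟶ n) : (coneMap f).toOrderHom 0 = 0 := rfl

lemma coneMap_succ {m n : SimplexCategory} (f : m ⟶ n) (j : Fin (m.len + 1)) :
    (coneMap f).toOrderHom j.succ = (f.toOrderHom j).succ := rfl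

/-- The functor that adds an initial vertex. -/
def cone : SimplexCategory ⥤ SimplexCategory where
  obj n := ⦋n.len + 1⦌
  map f := coneMap f
  map_id n := simplexHom_ext fun k => by cases k using Fin.cases <;> rfl
  map_comp f g := simplexHom_ext fun k => by cases k using Fin.cases <;> rfl

/-- The inclusion of the base of the cone. -/
def coneBase (n : SimplexCategory) : n ⟶ ⦋n.len + 1⦌ :=
  SimplexCategory.Hom.mk ⟨Fin.succ, fun _ _ h => Fin.succ_le_succ_iff.2 h⟩

/-- The map to `n` with constant value `i`. -/
def constTo (m : SimplexCategory) {n : SimplexCategory} (i : Fin (n.len + 1)) : m ⟶ n :=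
  SimplexCategory.Hom.mk ⟨fun _ => i, fun _ _ _ => le_rfl⟩

/-- The map of cones that collapses the vertices up to `i` to the cone point. -/
def coneCollapse {n : ℕ} (i : Fin (n + 1)) : ⦋n + 2⦌ ⟶ ⦋n + 1⦌ :=
  -- The cone point is vertex 0 and base vertex `j` has number `j + 1`; thus `k ≤ i + 1` means the
  -- cone point or a base vertex up to `i`.
  SimplexCategory.Hom.mk ⟨fun k => if h : (k : ℕ) ≤ i + 1 then 0 else ⟨k - 1, by
    have := k.2; simp only [SimplexCategory.len_mk] at this ⊢; omega⟩, by
    intro a b h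
    have h' : (a : ℕ) ≤ b := h
    dsimp only
    split_ifs with h1 h2
    · exact le_rfl
    · exact Fin.zero_le _
    · omega
    · exact Fin.mk_le_mk.2 (by omega)⟩

lemma coneCollapse_val {n : ℕ} (i : Fin (n + 1)) (k : Fin (n + 3)) :
    ((coneCollapse i).toOrderHom k : ℕ) = if (k : ℕ) ≤ i + 1 then 0 else (k : ℕ) - 1 := by
  change ((if h : (k : ℕ) ≤ i + 1 then (0 : Fin (n + 2)) else ⟨k - 1, _⟩ : Fin (n + 2)) : ℕ) = _
  split_ifs <;> rfl

lemma coneMap_δ_val {n : ℕ} (i : Fin (n + 2)) (k : Fin (n + 2)) :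
    ((coneMap (SimplexCategory.δ i)).toOrderHom k : ℕ) =
      if (k : ℕ) < i + 1 then (k : ℕ) else k + 1 := by
  cases k using Fin.cases with
  | zero => simp [coneMap_zero]
  | succ k =>
    rw [coneMap_succ, Fin.val_succ, Fin.val_succ, δ_val]
    split_ifs <;> omega

lemma coneMap_σ_val {n : ℕ} (i : Fin (n + 1)) (k : Fin (n + 3)) :
    ((coneMap (SimplexCategory.σ i)).toOrderHom k : ℕ) =
      if (i : ℕ) + 1 < k then (k : ℕ) - 1 else k := by
  cases k using Fin.cases with
  | zero => simp [coneMap_zero]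
  | succ k =>
    rw [coneMap_succ, Fin.val_succ, Fin.val_succ, σ_val]
    split_ifs <;> omega

lemma map_map_apply (A : SimplicialSpace.{u}) {l m n : SimplexCategory} (f : l ⟶ m) (g : m ⟶ n)
    (a : A.obj (op n)) :
    (A.map f.op).hom ((A.map g.op).hom a) = (A.map (f ≫ g).op).hom a := by
  rw [op_comp, A.map_comp]
  rfl

lemma map_id_apply (A : SimplicialSpace.{u}) (n : SimplexCategory) (a : A.obj (op n)) :
    (A.map (𝟙 n).op).hom a = a := by
  rw [op_id, A.map_id]
  rfl

lemma map_map_congr (A : SimplicialSpace.{u}) {l m m' n : SimplexCategory} {f : l ⟶ m}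
    {g : m ⟶ n} {f' : l ⟶ m'} {g' : m' ⟶ n}
    (h : ∀ k, (g.toOrderHom (f.toOrderHom k) : ℕ) = g'.toOrderHom (f'.toOrderHom k))
    (a : A.obj (op n)) :
    (A.map f.op).hom ((A.map g.op).hom a) = (A.map f'.op).hom ((A.map g'.op).hom a) := by
  rw [map_map_apply, map_map_apply, simplexHom_ext (f := f ≫ g) (g := f' ≫ g') h]

lemma map_map_eq_self (A : SimplicialSpace.{u}) {m n : SimplexCategory} {f : n ⟶ m} {g : m ⟶ n}
    (h : ∀ k, (g.toOrderHom (f.toOrderHom k) : ℕ) = k) (a : A.obj (op n)) :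
    (A.map f.op).hom ((A.map g.op).hom a) = a := by
  rw [map_map_apply, simplexHom_ext (f := f ≫ g) (g := 𝟙 n) h, map_id_apply]

/-- The simplicial subspace given by a stable family of subspaces. -/
def subSpace (A : SimplicialSpace.{u}) (S : ∀ n, Submodule ℂ (A.obj (op n)))
    (hS : ∀ {m n} (f : m ⟶ n), ∀ a ∈ S n, (A.map f.op).hom a ∈ S m) : SimplicialSpace.{u} where
  obj n := ModuleCat.of ℂ (S n.unop)
  map f := ModuleCat.ofHom ((A.map f).hom.restrict (hS f.unop))
  map_id n := by
    refine ModuleCat.hom_ext (LinearMap.ext fun a => Subtype.ext ?_)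
    exact map_id_apply A n.unop a.1
  map_comp f g := by
    refine ModuleCat.hom_ext (LinearMap.ext fun a => Subtype.ext ?_)
    exact (map_map_apply A g.unop f.unop a.1).symm

section Path

variable (A : SimplicialSpace.{u})

/-- Evaluation at the cone point. -/
abbrev conePoint (n : SimplexCategory) : A.obj (op (cone.obj n)) →ₗ[ℂ] A.obj (op ⦋0⦌) :=
  (A.map (constTo ⦋0⦌ (n := ⦋n.len + 1⦌) 0).op).hom

/-- Restriction to the base of the cone. -/
abbrev coneRestrict (n : SimplexCategory) : A.obj (op (cone.obj n)) →ₗ[ℂ] A.obj (op n) :=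
  (A.map (coneBase n).op).hom

lemma conePoint_map {m n : SimplexCategory} (f : m ⟶ n) (a : A.obj (op (cone.obj n))) :
    conePoint A m ((A.map (coneMap f).op).hom a) = conePoint A n a := by
  refine (map_map_apply A (constTo ⦋0⦌ (n := ⦋m.len + 1⦌) 0) (coneMap f) a).trans ?_
  rfl

lemma coneRestrict_map {m n : SimplexCategory} (f : m ⟶ n) (a : A.obj (op (cone.obj n))) :
    coneRestrict A m ((A.map (coneMap f).op).hom a) = (A.map f.op).hom (coneRestrict A n a) := by
  refine (map_map_apply A (coneBase m) (coneMap f) a).trans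
    (Eq.trans ?_ (map_map_apply A f (coneBase n) a).symm)
  rfl

/-- The simplicial space of paths that start at `0`. -/
def pathSpace : SimplicialSpace.{u} :=
  subSpace (cone.op ⋙ A) (fun n => LinearMap.ker (conePoint A n)) fun f a ha =>
    (conePoint_map A f a).trans ha

/-- The simplicial space of loops at `0`. -/
def loopSpace : SimplicialSpace.{u} :=
  subSpace (cone.op ⋙ A)
    (fun n => LinearMap.ker (conePoint A n) ⊓ LinearMap.ker (coneRestrict A n)) fun f a ha =>
    ⟨(conePoint_map A f a).trans ha.1, (coneRestrict_map A f a).trans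
      ((congrArg (A.map f.op).hom ha.2).trans (map_zero _))⟩

/-- The inclusion of loops into paths. -/
def loopInclusion : loopSpace A ⟶ pathSpace A where
  app n := ModuleCat.ofHom (Submodule.inclusion
    (p := LinearMap.ker (conePoint A n.unop) ⊓ LinearMap.ker (coneRestrict A n.unop)) inf_le_left)
  naturality _ _ _ := rfl

lemma coneCollapse_mem {n : ℕ} (i : Fin (n + 1)) (a : A.obj (op ⦋n + 1⦌))
    (ha : a ∈ LinearMap.ker (conePoint A ⦋n⦌)) :
    (A.map (coneCollapse i).op).hom a ∈ LinearMap.ker (conePoint A ⦋n + 1⦌) := by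
  have h : constTo ⦋0⦌ (n := ⦋n + 2⦌) 0 ≫ coneCollapse i = constTo ⦋0⦌ (n := ⦋n + 1⦌) 0 :=
    simplexHom_ext fun k => by
      change ((coneCollapse i).toOrderHom 0 : ℕ) = 0
      rw [coneCollapse_val]
      simp
  refine (map_map_apply A _ _ a).trans ?_
  rw [h]
  exact ha

/-- The contraction of the path object. -/
def pathContraction :
    SimplicialObject.Homotopy (X := pathSpace A) (Y := pathSpace A)
      { app := fun n => 0, naturality := fun _ _ _ => by simp } (𝟙 (pathSpace A)) where
  h {n} i := ModuleCat.ofHom ((A.map (coneCollapse i).op).hom.restrict (coneCollapse_mem A i))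
  h_zero_comp_δ_zero n := by
    refine ModuleCat.hom_ext (LinearMap.ext fun a => Subtype.ext ?_)
    refine map_map_eq_self A (f := coneMap (SimplexCategory.δ 0)) (g := coneCollapse 0)
      (fun k => ?_) a.1
    rw [coneCollapse_val, coneMap_δ_val]
    by_cases hk : (k : ℕ) < 1
    · simp [hk]
      split_ifs <;> omega
    · simp only [hk, Fin.val_zero, zero_add, if_false]
      rw [if_neg (by omega), Nat.add_sub_cancel]
  h_last_comp_δ_last n := by
    refine ModuleCat.hom_ext (LinearMap.ext fun a => Subtype.ext ?_)
    -- At the last stage everything is collapsed to the cone point, where a path is zero by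
    -- definition. This is what makes the homotopy start at the zero map.
    have h : coneMap (SimplexCategory.δ (Fin.last (n + 1))) ≫ coneCollapse (Fin.last n) =
        constTo _ (n := ⦋0⦌) 0 ≫ constTo ⦋0⦌ (n := ⦋n + 1⦌) 0 := simplexHom_ext fun k => by
      change ((coneCollapse _).toOrderHom ((coneMap _).toOrderHom k) : ℕ) = 0
      have hk := k.2
      rw [coneCollapse_val, coneMap_δ_val]
      simp only [Fin.val_last, SimplexCategory.len_mk] at hk ⊢
      split_ifs <;> omega
    refine (map_map_apply A (coneMap (SimplexCategory.δ (Fin.last (n + 1))))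
      (coneCollapse (Fin.last n)) a.1).trans ?_
    rw [h]
    refine (map_map_apply A _ _ a.1).symm.trans ?_
    exact (congrArg (A.map _).hom a.2).trans (map_zero _)
  h_succ_comp_δ_castSucc_of_lt i j hij := by
    rw [Fin.le_def, Fin.val_castSucc] at hij
    refine ModuleCat.hom_ext (LinearMap.ext fun a => Subtype.ext ?_)
    refine map_map_congr A (f := coneMap (SimplexCategory.δ i.castSucc)) (g := coneCollapse j.succ)
      (f' := coneCollapse j) (g' := coneMap (SimplexCategory.δ i)) (fun k => ?_) a.1
    rw [coneCollapse_val, coneMap_δ_val, coneMap_δ_val, coneCollapse_val]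
    simp only [Fin.val_succ, Fin.val_castSucc]
    split_ifs <;> omega
  h_succ_comp_δ_castSucc_succ j := by
    refine ModuleCat.hom_ext (LinearMap.ext fun a => Subtype.ext ?_)
    refine map_map_congr A (f := coneMap (SimplexCategory.δ j.castSucc.succ))
      (g := coneCollapse j.succ)
      (f' := coneMap (SimplexCategory.δ j.castSucc.succ)) (g' := coneCollapse j.castSucc)
        (fun k => ?_) a.1
    rw [coneCollapse_val, coneCollapse_val, coneMap_δ_val]
    simp only [Fin.val_succ, Fin.val_castSucc]
    split_ifs <;> omega
  h_castSucc_comp_δ_succ_of_lt i j hij := by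
    simp only [Fin.lt_def, Fin.val_castSucc] at hij
    refine ModuleCat.hom_ext (LinearMap.ext fun a => Subtype.ext ?_)
    refine map_map_congr A (f := coneMap (SimplexCategory.δ i.succ)) (g := coneCollapse j.castSucc)
      (f' := coneCollapse j) (g' := coneMap (SimplexCategory.δ i)) (fun k => ?_) a.1
    rw [coneCollapse_val, coneMap_δ_val, coneMap_δ_val, coneCollapse_val]
    simp only [Fin.val_succ, Fin.val_castSucc]
    split_ifs <;> omega
  h_comp_σ_castSucc_of_le i j hij := by
    rw [Fin.le_def] at hij
    refine ModuleCat.hom_ext (LinearMap.ext fun a => Subtype.ext ?_)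
    refine map_map_congr A (f := coneMap (SimplexCategory.σ i.castSucc)) (g := coneCollapse j)
      (f' := coneCollapse j.succ) (g' := coneMap (SimplexCategory.σ i)) (fun k => ?_) a.1
    rw [coneCollapse_val, coneMap_σ_val, coneMap_σ_val, coneCollapse_val]
    simp only [Fin.val_succ, Fin.val_castSucc]
    split_ifs <;> omega
  h_comp_σ_succ_of_lt i j hij := by
    rw [Fin.le_def] at hij
    refine ModuleCat.hom_ext (LinearMap.ext fun a => Subtype.ext ?_)
    refine map_map_congr A (f := coneMap (SimplexCategory.σ i.succ)) (g := coneCollapse j)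
      (f' := coneCollapse j.castSucc) (g' := coneMap (SimplexCategory.σ i)) (fun k => ?_) a.1
    rw [coneCollapse_val, coneMap_σ_val, coneMap_σ_val, coneCollapse_val]
    simp only [Fin.val_succ, Fin.val_castSucc]
    split_ifs <;> omega

end Path

/-! ### Splitting off the components -/

section Components

variable (A : SimplicialSpace.{u})

/-- The value of a simplicial space element at the vertex `i`. -/
abbrev vertex {n : SimplexCategory} (i : Fin (n.len + 1)) :
    A.obj (op n) →ₗ[ℂ] A.obj (op ⦋0⦌) :=
  (A.map (constTo ⦋0⦌ i).op).hom

/-- Differences of end points of edges. -/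
def boundaries : Submodule ℂ (A.obj (op ⦋0⦌)) :=
  LinearMap.range (vertex A (n := ⦋1⦌) 1 - vertex A (n := ⦋1⦌) 0)

lemma vertex_map {m n : SimplexCategory} (f : m ⟶ n) (i : Fin (m.len + 1)) (a : A.obj (op n)) :
    vertex A i ((A.map f.op).hom a) = vertex A (f.toOrderHom i) a :=
  map_map_apply A _ _ a

lemma vertex_degenerate (n : SimplexCategory) (i : Fin (n.len + 1)) (x : A.obj (op ⦋0⦌)) :
    vertex A i ((A.map (constTo n (n := ⦋0⦌) 0).op).hom x) = x :=
  map_map_eq_self A (fun k => by have := k.2; simp only [SimplexCategory.len_mk] at this ⊢; omega) x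

/-- The map that fixes the initial vertex and sends all other vertices to `i`. -/
def collapseTo (m : SimplexCategory) {n : SimplexCategory} (i : Fin (n.len + 1)) : m ⟶ n :=
  SimplexCategory.Hom.mk ⟨fun k => if k = 0 then 0 else i, by
    intro a b h
    by_cases ha : a = 0
    · simp [ha]
    · have hb : b ≠ 0 := fun hb => ha (Fin.le_zero_iff.1 (hb ▸ h))
      simp [ha, hb]⟩

/-- The restriction of `a` to the edge from vertex 0 to vertex `i` has this boundary. -/
lemma vertex_sub_vertex_mem {n : SimplexCategory} (i : Fin (n.len + 1)) (a : A.obj (op n)) :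
    vertex A i a - vertex A 0 a ∈ boundaries A := by
  refine ⟨(A.map (collapseTo ⦋1⦌ i).op).hom a, ?_⟩
  rw [LinearMap.sub_apply, vertex_map, vertex_map]
  rfl

/-- The space of connected components. -/
abbrev components : Type u := A.obj (op ⦋0⦌) ⧸ boundaries A

/-- The component of an element. -/
def componentMap : A ⟶ constSpace (components A) where
  app n := ModuleCat.ofHom ((boundaries A).mkQ ∘ₗ vertex A (n := n.unop) 0)
  naturality n m f := by
    refine ModuleCat.hom_ext (LinearMap.ext fun a => ?_)
    refine (Submodule.Quotient.eq _).2 ?_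
    -- A simplicial operator may move the initial vertex, but vertices of one simplex differ by a
    -- boundary.
    have h := vertex_sub_vertex_mem A (f.unop.toOrderHom 0) a
    rw [← vertex_map] at h
    exact h

lemma componentMap_eq_zero_iff {n : SimplexCategory} (a : A.obj (op n)) :
    ((componentMap A).app (op n)).hom a = 0 ↔ vertex A 0 a ∈ boundaries A :=
  Submodule.Quotient.mk_eq_zero _

/-- A linear section of the projection to the components. -/
def componentSection : components A →ₗ[ℂ] A.obj (op ⦋0⦌) :=
  ((boundaries A).mkQ.exists_rightInverse_of_surjective (Submodule.range_mkQ _)).choose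

lemma mkQ_componentSection (w : components A) :
    (boundaries A).mkQ (componentSection A w) = w :=
  LinearMap.congr_fun ((boundaries A).mkQ.exists_rightInverse_of_surjective
    (Submodule.range_mkQ _)).choose_spec w

/-- The section extended by degeneracies. -/
def componentInclusion : constSpace (components A) ⟶ A where
  app n := ModuleCat.ofHom ((A.map (constTo n.unop (n := ⦋0⦌) 0).op).hom ∘ₗ componentSection A)
  naturality n m f := by
    refine ModuleCat.hom_ext (LinearMap.ext fun w => ?_)
    exact (map_map_apply A f.unop (constTo n.unop (n := ⦋0⦌) 0) _).symm

lemma componentInclusion_componentMap :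
    componentInclusion A ≫ componentMap A = 𝟙 (constSpace (components A)) := by
  refine NatTrans.ext (funext fun n => ModuleCat.hom_ext (LinearMap.ext fun w => ?_))
  exact (congrArg (boundaries A).mkQ (vertex_degenerate A n.unop 0 _)).trans
    (mkQ_componentSection A w)

/-- The kernel of the component map. -/
def reduced : SimplicialSpace.{u} :=
  subSpace A (fun n => LinearMap.ker ((componentMap A).app (op n)).hom) fun f a ha =>
    LinearMap.mem_ker.2 ((congrArg (fun φ => φ.hom a) ((componentMap A).naturality f.op)).trans
      (LinearMap.mem_ker.1 ha))

/-- The inclusion of the reduced part. -/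
def reducedInclusion : reduced A ⟶ A where
  app _ := ModuleCat.ofHom (Submodule.subtype _)
  naturality _ _ _ := rfl

lemma componentMap_componentInclusion_apply (n : SimplexCategoryᵒᵖ) (a : A.obj n) :
    ((componentMap A).app n).hom (((componentInclusion A).app n).hom
      (((componentMap A).app n).hom a)) = ((componentMap A).app n).hom a :=
  congrArg (fun φ => (φ.app n).hom (((componentMap A).app n).hom a))
    (componentInclusion_componentMap A)

/-- The projection to the reduced part. -/
def reducedProjection : A ⟶ reduced A where
  app n := ModuleCat.ofHom (LinearMap.codRestrict _
    (LinearMap.id - ((componentInclusion A).app n).hom ∘ₗ ((componentMap A).app n).hom) fun a => by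
      refine LinearMap.mem_ker.2 ?_
      refine (map_sub ((componentMap A).app n).hom _ _).trans (sub_eq_zero.2 ?_)
      exact (componentMap_componentInclusion_apply A n a).symm)
  naturality n m f := by
    refine ModuleCat.hom_ext (LinearMap.ext fun a => Subtype.ext ?_)
    refine Eq.trans ?_ (map_sub (A.map f).hom _ _).symm
    refine congrArg ((A.map f).hom a - ·) ?_
    exact congrArg (fun φ => φ.hom a) ((componentMap A ≫ componentInclusion A).naturality f)

/-- `A` is the direct sum of the constant space on its components and its reduced part, and `Hom(-,
B)` respects direct sums. -/
lemma isExactAt_homSpace_iff_components_reduced (B : CosimplicialSpace.{u}) (n : ℕ) :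
    IsExactAt (homSpace A B) n ↔
      (Subsingleton (components A) ∨ IsExactAt B n) ∧ IsExactAt (homSpace (reduced A) B) n := by
  rw [← isExactAt_homSpace_constSpace_iff]
  refine isExactAt_iff_of_binary (homSpaceMap (componentMap A) B)
    (homSpaceMap (componentInclusion A) B) (homSpaceMap (reducedProjection A) B)
    (homSpaceMap (reducedInclusion A) B) ?_ ?_ ?_ n
  · refine NatTrans.ext (funext fun m => ModuleCat.hom_ext (LinearMap.ext
      fun (u : components A →ₗ[ℂ] B.obj m) => LinearMap.ext fun w => ?_))
    exact congrArg (fun φ => u ((φ.app (op m)).hom w)) (componentInclusion_componentMap A)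
  · refine NatTrans.ext (funext fun m => ModuleCat.hom_ext (LinearMap.ext
      fun (u : (reduced A).obj (op m) →ₗ[ℂ] B.obj m) => LinearMap.ext fun w => ?_))
    refine congrArg u (Subtype.ext ?_)
    refine (congrArg (w.1 - ·) ?_).trans (sub_zero w.1)
    exact (congrArg ((componentInclusion A).app _).hom w.2).trans (map_zero _)
  · intro m (u : A.obj (op m) →ₗ[ℂ] B.obj m)
    refine LinearMap.ext fun a => ?_
    refine (map_add u _ _).symm.trans (congrArg u ?_)
    exact add_sub_cancel _ _

/-! ### Paths in the reduced part -/

/-- The cone point, where `a` vanishes, is joined by an edge to the initial vertex of the base; so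
the base lies in the zero component. -/
lemma coneRestrict_mem (n : SimplexCategory) (a : A.obj (op ⦋n.len + 1⦌))
    (ha : vertex A 0 a = 0) : ((componentMap A).app (op n)).hom (coneRestrict A n a) = 0 := by
  have h := vertex_sub_vertex_mem A ((coneBase n).toOrderHom 0) a
  rw [ha, sub_zero, ← vertex_map] at h
  exact (componentMap_eq_zero_iff A _).2 h

/-- The end point map from paths. -/
def pathEnd : pathSpace A ⟶ reduced A where
  app n := ModuleCat.ofHom (LinearMap.codRestrict _
    (coneRestrict A n.unop ∘ₗ Submodule.subtype _) fun a =>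
      coneRestrict_mem A n.unop a.1 a.2)
  naturality n m f := by
    refine ModuleCat.hom_ext (LinearMap.ext fun a => Subtype.ext ?_)
    exact coneRestrict_map A f.unop a.1

lemma loopInclusion_injective (n : SimplexCategoryᵒᵖ) :
    Function.Injective ((loopInclusion A).app n).hom :=
  Submodule.inclusion_injective (p := LinearMap.ker (conePoint A n.unop) ⊓
    LinearMap.ker (coneRestrict A n.unop)) inf_le_left

lemma pathEnd_eq_zero_iff (n : SimplexCategoryᵒᵖ) (a : (pathSpace A).obj n) :
    ((pathEnd A).app n).hom a = 0 ↔ ∃ b, ((loopInclusion A).app n).hom b = a := by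
  constructor
  · intro h
    exact ⟨⟨a.1, a.2, congrArg Subtype.val h⟩, rfl⟩
  · rintro ⟨b, rfl⟩
    exact Subtype.ext b.2.2

/-- The map that identifies the cone point with the initial vertex of the base. -/
def coneToBase (n : SimplexCategory) : ⦋n.len + 1⦌ ⟶ n :=
  SimplexCategory.Hom.mk ⟨fun k => ⟨k - 1, by
    have := k.2; simp only [SimplexCategory.len_mk] at this; omega⟩,
    fun _ _ h => Fin.mk_le_mk.2 (Nat.sub_le_sub_right h 1)⟩

/-- An element in the zero component is joined to zero by an edge at its initial vertex. Subtracting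
that edge, spread over the cone, from the degenerate cone on the element gives a path from zero to
it. -/
lemma pathEnd_surjective (n : SimplexCategoryᵒᵖ) :
    Function.Surjective ((pathEnd A).app n).hom := by
  rintro ⟨a, ha⟩
  obtain ⟨e, he⟩ := (componentMap_eq_zero_iff A a).1 ha
  obtain ⟨n⟩ := n
  rw [LinearMap.sub_apply] at he
  -- Since `e` satisfies `e₁ - e₀ = a₀`, the edge `s(e₁) - e` runs from `a₀` to `0`.
  let f : A.obj (op ⦋1⦌) := (A.map (constTo ⦋1⦌ (n := ⦋0⦌) 0).op).hom (vertex A (n := ⦋1⦌) 1 e) - e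
  have hf0 : vertex A (n := ⦋1⦌) 0 f = vertex A 0 a := by
    rw [map_sub, vertex_degenerate, he]
  have hf1 : vertex A (n := ⦋1⦌) 1 f = 0 := by
    rw [map_sub, vertex_degenerate, sub_self]
  -- At the cone point both terms are `a₀`; on the base the first is `a` and the second is
  -- degenerate on the vertex `0` of value zero.
  let p : A.obj (op ⦋n.len + 1⦌) := (A.map (coneToBase n).op).hom a -
    (A.map (collapseTo ⦋n.len + 1⦌ (n := ⦋1⦌) 1).op).hom f
  have hp0 : conePoint A n p = 0 := by
    have h1 := vertex_map A (coneToBase n) 0 a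
    have h2 := vertex_map A (collapseTo ⦋n.len + 1⦌ (n := ⦋1⦌) 1) 0 f
    exact (map_sub (vertex A 0) _ _).trans (sub_eq_zero.2 (h1.trans (hf0.symm.trans h2.symm)))
  have hp1 : coneRestrict A n p = a := by
    have h1 : coneRestrict A n ((A.map (coneToBase n).op).hom a) = a :=
      map_map_eq_self A (fun k => rfl) a
    have h2 : coneRestrict A n ((A.map (collapseTo ⦋n.len + 1⦌ (n := ⦋1⦌) 1).op).hom f) = 0 := by
      refine (map_map_congr A (f := coneBase n) (g := collapseTo ⦋n.len + 1⦌ (n := ⦋1⦌) 1)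
        (f' := constTo n (n := ⦋0⦌) 0) (g' := constTo ⦋0⦌ (n := ⦋1⦌) 1)
        (fun k => rfl) f).trans ?_
      exact (congrArg (A.map _).hom hf1).trans (map_zero _)
    exact (map_sub (coneRestrict A n) _ _).trans ((congrArg₂ _ h1 h2).trans (sub_zero a))
  exact ⟨⟨p, hp0⟩, Subtype.ext hp1⟩

end Components

/-! ### The degree shift and the Künneth criterion -/

lemma isExactAt_homSpace_pathSpace (A : SimplicialSpace.{u}) (B : CosimplicialSpace.{u}) (n : ℕ) :
    IsExactAt (homSpace (pathSpace A) B) n :=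
  isExactAt_homSpace_of_homotopy (fun _ => rfl) (pathContraction A) B n

lemma isExactAt_homSpace_reduced_zero (A : SimplicialSpace.{u}) (B : CosimplicialSpace.{u}) :
    IsExactAt (homSpace (reduced A) B) 0 :=
  isExactAt_zero_of_shortExact (homSpaceMap (pathEnd A) B)
    (homSpaceMap_injective _ (pathEnd_surjective A) B) (isExactAt_homSpace_pathSpace A B)

lemma isExactAt_homSpace_reduced_succ_iff (A : SimplicialSpace.{u}) (B : CosimplicialSpace.{u})
    (n : ℕ) :
    IsExactAt (homSpace (reduced A) B) (n + 1) ↔ IsExactAt (homSpace (loopSpace A) B) n :=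
  isExactAt_succ_iff_of_shortExact (homSpaceMap (pathEnd A) B) (homSpaceMap (loopInclusion A) B)
    (homSpaceMap_injective _ (pathEnd_surjective A) B)
    (homSpaceMap_surjective _ (loopInclusion_injective A) B)
    (homSpaceMap_exact _ _ (pathEnd_surjective A) (pathEnd_eq_zero_iff A) B)
    (isExactAt_homSpace_pathSpace A B) n

/-- The Künneth theorem for `n ↦ Hom(A_n, B^n)`, in the form of a criterion for exactness. -/
theorem isExactAt_homSpace_iff (A : SimplicialSpace.{u}) (B : CosimplicialSpace.{u}) (n : ℕ) :
    IsExactAt (homSpace A B) n ↔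
      ∀ i j, i + j = n → IsExactAt (homSpace A unitSpace) i ∨ IsExactAt B j := by
  -- `A` varies because the inductive step replaces it by its loop space; `B` stays fixed.
  induction n generalizing A with
  | zero =>
    rw [isExactAt_homSpace_iff_components_reduced,
      and_iff_left (isExactAt_homSpace_reduced_zero A B)]
    have h : IsExactAt (homSpace A unitSpace) 0 ↔ Subsingleton (components A) := by
      rw [isExactAt_homSpace_iff_components_reduced,
        and_iff_left (isExactAt_homSpace_reduced_zero A _), isExactAt_unitSpace_iff]
      simp
    rw [← h]
    constructor
    · rintro h' i j hij
      obtain ⟨rfl, rfl⟩ := Nat.add_eq_zero_iff.1 hij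
      exact h'
    · exact fun h' => h' 0 0 rfl
  | succ n ih =>
    have h0 : IsExactAt (homSpace A unitSpace) 0 ↔ Subsingleton (components A) := by
      rw [isExactAt_homSpace_iff_components_reduced,
        and_iff_left (isExactAt_homSpace_reduced_zero A _), isExactAt_unitSpace_iff]
      simp
    -- The shift with one-dimensional coefficients: in positive degree the components contribute
    -- nothing, so the cohomology of `A` in degree `i + 1` is seen in degree `i` of the loop space.
    have h1 (i : ℕ) : IsExactAt (homSpace A unitSpace) (i + 1) ↔
        IsExactAt (homSpace (loopSpace A) unitSpace) i := by
      rw [isExactAt_homSpace_iff_components_reduced, isExactAt_homSpace_reduced_succ_iff,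
        isExactAt_unitSpace_iff]
      simp
    rw [isExactAt_homSpace_iff_components_reduced, isExactAt_homSpace_reduced_succ_iff, ih, ← h0]
    constructor
    · rintro ⟨ha, hb⟩ i j hij
      cases i with
      | zero =>
        obtain rfl : j = n + 1 := by omega
        exact ha
      | succ i =>
        rw [h1]
        exact hb i j (by omega)
    · intro h
      refine ⟨h 0 (n + 1) (by omega), fun i j hij => ?_⟩
      rw [← h1]
      exact h (i + 1) j (by omega)

/-! ### Singular chains with coefficients in the dual local system -/

section Chains

variable {X : Type u} [TopologicalSpace X] (V : LocalSystem X)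

open Classical in
/-- Singular chains with coefficients in the dual of `V`. -/
abbrev SingularChain (n : SimplexCategory) : Type u :=
  DirectSum C(Simplex n, X) fun σ => Module.Dual ℂ (V.obj ⟨σ (vertexZero n)⟩)

open Classical in
/-- The elementary chain with simplex `σ`. -/
def elementaryChain {n : SimplexCategory} (σ : C(Simplex n, X)) :
    Module.Dual ℂ (V.obj ⟨σ (vertexZero n)⟩) →ₗ[ℂ] SingularChain V n :=
  DirectSum.lof ℂ _ (fun σ : C(Simplex n, X) => Module.Dual ℂ (V.obj ⟨σ (vertexZero n)⟩)) σ

open Classical in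
/-- The linear map on chains with given restrictions to elementary chains. -/
def chainLift {n : SimplexCategory} {E : Type*} [AddCommGroup E] [Module ℂ E]
    (φ : ∀ σ : C(Simplex n, X), Module.Dual ℂ (V.obj ⟨σ (vertexZero n)⟩) →ₗ[ℂ] E) :
    SingularChain V n →ₗ[ℂ] E :=
  DirectSum.toModule ℂ _ _ φ

lemma chainLift_elementaryChain {n : SimplexCategory} {E : Type*} [AddCommGroup E] [Module ℂ E]
    (φ : ∀ σ : C(Simplex n, X), Module.Dual ℂ (V.obj ⟨σ (vertexZero n)⟩) →ₗ[ℂ] E)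
    (σ : C(Simplex n, X)) (l : Module.Dual ℂ (V.obj ⟨σ (vertexZero n)⟩)) :
    chainLift V φ (elementaryChain V σ l) = φ σ l := by
  classical
  exact DirectSum.toModule_lof ..

lemma chain_hom_ext {n : SimplexCategory} {E : Type*} [AddCommGroup E] [Module ℂ E]
    {f g : SingularChain V n →ₗ[ℂ] E}
    (h : ∀ σ l, f (elementaryChain V σ l) = g (elementaryChain V σ l)) : f = g := by
  classical
  exact DirectSum.linearMap_ext _ fun σ => LinearMap.ext fun l => h σ l

/-- The evaluation of a cochain on chains. -/
def evalCochain {n : SimplexCategory} (c : SingularCochain V n) : SingularChain V n →ₗ[ℂ] ℂ :=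
  chainLift V fun σ => Module.Dual.eval ℂ _ (c σ)

lemma evalCochain_elementaryChain {n : SimplexCategory} (c : SingularCochain V n)
    (σ : C(Simplex n, X)) (l : Module.Dual ℂ (V.obj ⟨σ (vertexZero n)⟩)) :
    evalCochain V c (elementaryChain V σ l) = l (c σ) :=
  chainLift_elementaryChain ..

/-- Cochains supported on a single simplex already separate chains. With `evalCochain_cochainMap`,
this deduces functoriality of chains from that of cochains. -/
lemma chain_ext {n : SimplexCategory} {a b : SingularChain V n}
    (h : ∀ c, evalCochain V c a = evalCochain V c b) : a = b := by
  classical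
  have key (σ : C(Simplex n, X)) (v : V.obj ⟨σ (vertexZero n)⟩) :
      evalCochain V (Pi.single σ v) = (Module.Dual.eval ℂ _ v) ∘ₗ
        DirectSum.component ℂ _ (fun σ : C(Simplex n, X) =>
          Module.Dual ℂ (V.obj ⟨σ (vertexZero n)⟩)) σ := by
    refine chain_hom_ext V fun τ l => ?_
    rw [evalCochain_elementaryChain, LinearMap.comp_apply, elementaryChain]
    rcases eq_or_ne τ σ with rfl | hne
    · rw [Pi.single_eq_same, DirectSum.component.lof_self]
      rfl
    · rw [Pi.single_eq_of_ne hne, map_zero, DirectSum.component.of, dif_neg hne, map_zero]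
  refine DFinsupp.ext fun σ => LinearMap.ext fun v => ?_
  have h' := h (Pi.single σ v)
  rw [key] at h'
  exact h'

/-- The operation of `f : m ⟶ n` on chains. -/
def chainMap {m n : SimplexCategory} (f : m ⟶ n) : SingularChain V n →ₗ[ℂ] SingularChain V m :=
  chainLift V fun σ => elementaryChain V (σ.comp (simplexMap f)) ∘ₗ
    (V.transport σ (simplexMap f (vertexZero m)) (vertexZero n)).dualMap

lemma chainMap_elementaryChain {m n : SimplexCategory} (f : m ⟶ n)
    (σ : C(Simplex n, X)) (l : Module.Dual ℂ (V.obj ⟨σ (vertexZero n)⟩)) :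
    chainMap V f (elementaryChain V σ l) = elementaryChain V (σ.comp (simplexMap f))
      (l ∘ₗ V.transport σ (simplexMap f (vertexZero m)) (vertexZero n)) :=
  chainLift_elementaryChain ..

lemma evalCochain_cochainMap {m n : SimplexCategory} (f : m ⟶ n) (c : SingularCochain V m)
    (a : SingularChain V n) :
    evalCochain V (cochainMap V f c) a = evalCochain V c (chainMap V f a) := by
  refine LinearMap.congr_fun (g := evalCochain V c ∘ₗ chainMap V f)
    (chain_hom_ext V fun σ l => ?_) a
  rw [LinearMap.comp_apply, chainMap_elementaryChain, evalCochain_elementaryChain,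
    evalCochain_elementaryChain]
  rfl

/-- The simplicial space of singular chains. -/
def chainSpace : SimplicialSpace.{u} where
  obj n := ModuleCat.of ℂ (SingularChain V n.unop)
  map f := ModuleCat.ofHom (chainMap V f.unop)
  map_id n := by
    refine ModuleCat.hom_ext (LinearMap.ext fun a => chain_ext V fun c => ?_)
    refine (evalCochain_cochainMap V (𝟙 n.unop) c a).symm.trans ?_
    rw [cochainMap_id]
    rfl
  map_comp f g := by
    refine ModuleCat.hom_ext (LinearMap.ext fun a => chain_ext V fun c => ?_)
    refine (evalCochain_cochainMap V (g.unop ≫ f.unop) c a).symm.trans ?_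
    rw [cochainMap_comp]
    refine (evalCochain_cochainMap V f.unop _ a).trans ?_
    exact evalCochain_cochainMap V g.unop c _

variable [∀ x, Module.Finite ℂ (V.obj x)]

/-- Singular cochains are dual to singular chains. -/
def cochainSpaceIso : cochainSpace V ≅ homSpace (chainSpace V) unitSpace :=
  NatIso.ofComponents (fun n => (LinearEquiv.ofBijective
    ({ toFun := fun c => ULift.moduleEquiv.symm.toLinearMap ∘ₗ evalCochain V c
       map_add' := fun c d => chain_hom_ext V fun σ l => by
        simp [evalCochain_elementaryChain]
        rfl
       map_smul' := fun z c => chain_hom_ext V fun σ l => by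
        simp [evalCochain_elementaryChain]
        rfl } :
      SingularCochain V n →ₗ[ℂ] (SingularChain V n →ₗ[ℂ] ULift.{u} ℂ)) (by
    constructor
    · intro c d h
      funext σ
      -- Finite-dimensional fibres are their own double duals.
      refine (Module.evalEquiv ℂ (V.obj ⟨σ (vertexZero n)⟩)).injective (LinearMap.ext fun l => ?_)
      have h' := congrArg ULift.down (LinearMap.congr_fun h (elementaryChain V σ l))
      change evalCochain V c _ = evalCochain V d _ at h'
      rwa [evalCochain_elementaryChain, evalCochain_elementaryChain] at h'
    · intro u
      refine ⟨fun σ => (Module.evalEquiv ℂ (V.obj ⟨σ (vertexZero n)⟩)).symm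
        (ULift.moduleEquiv.toLinearMap ∘ₗ u ∘ₗ elementaryChain V σ), chain_hom_ext V fun σ l => ?_⟩
      refine ULift.ext _ _ ?_
      refine (evalCochain_elementaryChain V _ σ l).trans ?_
      rw [Module.apply_evalEquiv_symm_apply]
      rfl)).toModuleIso) fun {m n} f => by
    refine ModuleCat.hom_ext (LinearMap.ext fun c => LinearMap.ext fun a => ULift.ext _ _ ?_)
    exact evalCochain_cochainMap V f c a

lemma isExactAt_homSpace_chainSpace_unitSpace_iff (n : ℕ) :
    IsExactAt (homSpace (chainSpace V) unitSpace) n ↔ IsExactAt (cochainSpace V) n :=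
  (isExactAt_congr (cochainSpaceIso V) n).symm

end Chains

/-! ### External tensor products of two local systems -/

section TensorHom

variable (E F : Type*) [AddCommGroup E] [Module ℂ E] [Module.Finite ℂ E] [AddCommGroup F]
  [Module ℂ F]

/-- `E ⊗ F` as the space of linear maps from the dual of `E` to `F`. -/
def tensorEquivHom : E ⊗[ℂ] F ≃ₗ[ℂ] (Module.Dual ℂ E →ₗ[ℂ] F) :=
  (TensorProduct.congr (Module.evalEquiv ℂ E) (LinearEquiv.refl ℂ F)).trans
    (dualTensorHomEquiv ℂ (Module.Dual ℂ E) F)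

variable {E F}

lemma tensorEquivHom_tmul (e : E) (f : F) (l : Module.Dual ℂ E) :
    tensorEquivHom E F (e ⊗ₜ f) l = l e • f := by
  simp [tensorEquivHom]

lemma tensorEquivHom_map {E' F' : Type*} [AddCommGroup E'] [Module ℂ E'] [Module.Finite ℂ E']
    [AddCommGroup F'] [Module ℂ F'] (S : E →ₗ[ℂ] E') (T : F →ₗ[ℂ] F') (x : E ⊗[ℂ] F)
    (l : Module.Dual ℂ E') :
    tensorEquivHom E' F' (TensorProduct.map S T x) l = T (tensorEquivHom E F x (l ∘ₗ S)) := by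
  induction x with
  | zero => simp
  | tmul e f => simp [tensorEquivHom_tmul]
  | add x y hx hy => simp [hx, hy]

end TensorHom

/-- The fibrewise tensor product of two local systems. -/
def tensorPair {Y : Type u} [TopologicalSpace Y] (V W : LocalSystem Y) : LocalSystem Y where
  obj y := ModuleCat.of ℂ (V.obj y ⊗[ℂ] W.obj y)
  map γ := ModuleCat.ofHom (TensorProduct.map (V.map γ).hom (W.map γ).hom)
  map_id y := by
    refine ModuleCat.hom_ext ?_
    rw [V.map_id, W.map_id]
    exact TensorProduct.map_id
  map_comp γ δ := by
    refine ModuleCat.hom_ext ?_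
    rw [V.map_comp, W.map_comp]
    exact TensorProduct.map_comp ..

section Box

variable {Z X Y : Type u} [TopologicalSpace Z] [TopologicalSpace X] [TopologicalSpace Y]
  (p : C(Z, X)) (q : C(Z, Y)) (V : LocalSystem X) (W : LocalSystem Y)

/-- The tensor product of the pullbacks along `p` and `q`. -/
def boxProduct : LocalSystem Z :=
  tensorPair (FundamentalGroupoid.map p ⋙ V) (FundamentalGroupoid.map q ⋙ W)

variable [∀ x, Module.Finite ℂ (V.obj x)]

/-- The component of a map from chains to cochains at a pair of simplices. -/
def homComponent {n : SimplexCategory} (σ : C(Simplex n, X)) (τ : C(Simplex n, Y)) :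
    (SingularChain V n →ₗ[ℂ] SingularCochain W n) →ₗ[ℂ]
      (Module.Dual ℂ (V.obj ⟨σ (vertexZero n)⟩) →ₗ[ℂ] W.obj ⟨τ (vertexZero n)⟩) where
  toFun u := LinearMap.proj τ ∘ₗ u ∘ₗ elementaryChain V σ
  map_add' _ _ := rfl
  map_smul' _ _ := rfl

/-- The cochain with coefficients in the external tensor product that corresponds to a map from
chains to cochains. -/
def boxCochain {n : SimplexCategory} :
    (SingularChain V n →ₗ[ℂ] SingularCochain W n) →ₗ[ℂ]
      ∀ ρ : C(Simplex n, Z), V.obj ⟨p (ρ (vertexZero n))⟩ ⊗[ℂ] W.obj ⟨q (ρ (vertexZero n))⟩ :=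
  LinearMap.pi fun ρ => (tensorEquivHom (V.obj ⟨p (ρ (vertexZero n))⟩)
    (W.obj ⟨q (ρ (vertexZero n))⟩)).symm.toLinearMap ∘ₗ
      homComponent V W (p.comp ρ) (q.comp ρ)

lemma tensorEquivHom_boxCochain {n : SimplexCategory}
    (u : SingularChain V n →ₗ[ℂ] SingularCochain W n) (ρ : C(Simplex n, Z))
    (l : Module.Dual ℂ (V.obj ⟨p (ρ (vertexZero n))⟩)) :
    tensorEquivHom (V.obj ⟨p (ρ (vertexZero n))⟩) (W.obj ⟨q (ρ (vertexZero n))⟩)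
      (boxCochain p q V W u ρ) l = u (elementaryChain V (p.comp ρ) l) (q.comp ρ) :=
  LinearMap.congr_fun (LinearEquiv.apply_symm_apply _ _) l

variable (hpq : ∀ n : SimplexCategory, Function.Bijective
  fun ρ : C(Simplex n, Z) => (p.comp ρ, q.comp ρ))

include hpq in
-- A map from chains on `X` to cochains on `Y` is a family of maps indexed by pairs of simplices,
-- and by `hpq` such pairs are the simplices of `Z`.
lemma boxCochain_bijective (n : SimplexCategory) :
    Function.Bijective (boxCochain p q V W (n := n)) := by
  constructor
  · rw [injective_iff_map_eq_zero]
    intro u hu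
    refine chain_hom_ext V fun σ l => funext fun τ => ?_
    obtain ⟨ρ, hρ⟩ := (hpq n).2 (σ, τ)
    obtain ⟨rfl, rfl⟩ := Prod.mk.inj hρ
    refine (tensorEquivHom_boxCochain p q V W u ρ l).symm.trans ?_
    rw [hu]
    exact LinearMap.congr_fun (map_zero (tensorEquivHom (V.obj ⟨p (ρ (vertexZero n))⟩)
      (W.obj ⟨q (ρ (vertexZero n))⟩))) l
  · intro c
    let e := Equiv.ofBijective _ (hpq n)
    let F : C(Simplex n, X) × C(Simplex n, Y) → Type := fun s =>
      Module.Dual ℂ (V.obj ⟨s.1 (vertexZero n)⟩) →ₗ[ℂ] W.obj ⟨s.2 (vertexZero n)⟩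
    let G : ∀ s, F s := Equiv.piCongrLeft F e fun ρ =>
      tensorEquivHom (V.obj ⟨p (ρ (vertexZero n))⟩) (W.obj ⟨q (ρ (vertexZero n))⟩) (c ρ)
    have hG (ρ) : G (e ρ) = tensorEquivHom (V.obj ⟨p (ρ (vertexZero n))⟩)
        (W.obj ⟨q (ρ (vertexZero n))⟩) (c ρ) := Equiv.piCongrLeft_apply_apply F e _ ρ
    refine ⟨chainLift V fun σ => LinearMap.pi fun τ => G (σ, τ), funext fun ρ => ?_⟩
    refine (tensorEquivHom (V.obj ⟨p (ρ (vertexZero n))⟩)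
      (W.obj ⟨q (ρ (vertexZero n))⟩)).injective (LinearMap.ext fun l => ?_)
    refine (tensorEquivHom_boxCochain p q V W _ ρ l).trans ?_
    rw [chainLift_elementaryChain]
    exact LinearMap.congr_fun (hG ρ) l

/-- Cochains with coefficients in an external tensor product are maps from chains to cochains. -/
def homSpaceChainSpaceIso :
    homSpace (chainSpace V) (cochainSpace W) ≅ cochainSpace (boxProduct p q V W) :=
  NatIso.ofComponents (fun n => (LinearEquiv.ofBijective (boxCochain p q V W)
    (boxCochain_bijective p q V W hpq n)).toModuleIso) fun {m n} f => by
    refine ModuleCat.hom_ext (LinearMap.ext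
      fun (u : SingularChain V m →ₗ[ℂ] SingularCochain W m) => funext fun ρ => ?_)
    refine (tensorEquivHom (V.obj ⟨p (ρ (vertexZero n))⟩)
      (W.obj ⟨q (ρ (vertexZero n))⟩)).injective (LinearMap.ext fun l => ?_)
    refine (tensorEquivHom_boxCochain p q V W _ ρ l).trans ?_
    let ρ' := ρ.comp (simplexMap f)
    have h₁ := tensorEquivHom_map (V.transport (p.comp ρ) (simplexMap f (vertexZero m))
      (vertexZero n)) (W.transport (q.comp ρ) (simplexMap f (vertexZero m)) (vertexZero n))
      (boxCochain p q V W u ρ') l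
    have h₂ := tensorEquivHom_boxCochain p q V W u ρ' (l ∘ₗ V.transport (p.comp ρ)
      (simplexMap f (vertexZero m)) (vertexZero n))
    have h₃ : cochainMap W f (u (chainMap V f (elementaryChain V (p.comp ρ) l))) (q.comp ρ) =
        W.transport (q.comp ρ) (simplexMap f (vertexZero m)) (vertexZero n)
          (u (elementaryChain V (p.comp ρ') (l ∘ₗ V.transport (p.comp ρ)
            (simplexMap f (vertexZero m)) (vertexZero n))) (q.comp ρ')) := by
      rw [chainMap_elementaryChain]
      rfl
    refine Eq.trans ?_ h₁.symm
    refine Eq.trans h₃ ?_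
    exact congrArg _ h₂.symm

include hpq in
/-- The Künneth theorem for two local systems, in the form of a criterion for exactness. -/
theorem isExactAt_boxProduct_iff (n : ℕ) :
    IsExactAt (cochainSpace (boxProduct p q V W)) n ↔
      ∀ i j, i + j = n → IsExactAt (cochainSpace V) i ∨ IsExactAt (cochainSpace W) j := by
  rw [← isExactAt_congr (homSpaceChainSpaceIso p q V W hpq), isExactAt_homSpace_iff]
  simp only [isExactAt_homSpace_chainSpace_unitSpace_iff]

end Box

/-! ### Complex representations -/

section Representations

variable {G H E F : Type*} [Monoid G] [Monoid H] [AddCommGroup E] [Module ℂ E] [AddCommGroup F]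
  [Module ℂ F] (ρ : Representation ℂ G E) (σ : Representation ℂ H F)

lemma isIrreducible_iff : ρ.IsIrreducible ↔ Nontrivial E ∧
    ∀ S : Submodule ℂ E, (∀ g, ∀ x ∈ S, ρ g x ∈ S) → S = ⊥ ∨ S = ⊤ := by
  constructor
  · intro h
    constructor
    · obtain ⟨x, hx⟩ := SetLike.not_le_iff_exists.1 (not_le_of_gt (bot_lt_top
        (α := Subrepresentation ρ)))
      exact ⟨x, 0, hx.2⟩
    · intro S hS
      exact (IsSimpleOrder.eq_bot_or_eq_top (⟨S, hS⟩ : Subrepresentation ρ)).imp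
        (congrArg Subrepresentation.toSubmodule) (congrArg Subrepresentation.toSubmodule)
  · rintro ⟨h, h'⟩
    obtain ⟨x, hx⟩ := exists_ne (0 : E)
    refine { exists_pair_ne := ⟨⊥, ⊤, fun he => hx ?_⟩, eq_bot_or_eq_top := fun S => ?_ }
    · have h2 : (⊥ : Submodule ℂ E) = ⊤ := congrArg Subrepresentation.toSubmodule he
      exact (Submodule.mem_bot ℂ).1 (h2 ▸ Submodule.mem_top)
    · exact (h' S.toSubmodule S.apply_mem_toSubmodule).imp
        (fun e => Subrepresentation.toSubmodule_injective e)
        (fun e => Subrepresentation.toSubmodule_injective e)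

lemma isSemisimple_iff : ρ.IsSemisimpleRepresentation ↔
    ∀ S : Submodule ℂ E, (∀ g, ∀ x ∈ S, ρ g x ∈ S) →
      ∃ T : Submodule ℂ E, (∀ g, ∀ x ∈ T, ρ g x ∈ T) ∧ IsCompl S T := by
  have hc (S T : Subrepresentation ρ) : IsCompl S T ↔ IsCompl S.toSubmodule T.toSubmodule := by
    simp only [isCompl_iff, disjoint_iff, codisjoint_iff]
    rw [← Subrepresentation.toSubmodule_injective.eq_iff,
      ← Subrepresentation.toSubmodule_injective.eq_iff]
    rfl
  constructor
  · intro h S hS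
    obtain ⟨T, hT⟩ := exists_isCompl (⟨S, hS⟩ : Subrepresentation ρ)
    exact ⟨T.toSubmodule, T.apply_mem_toSubmodule, (hc _ _).1 hT⟩
  · intro h
    refine ⟨fun S => ?_⟩
    obtain ⟨T, hT, hST⟩ := h S.toSubmodule S.apply_mem_toSubmodule
    exact ⟨⟨T, hT⟩, (hc _ _).2 hST⟩

/-- A sum of images of semisimple modules over the group algebra is semisimple. All later proofs of
semisimplicity for sums, quotients and tensor products pass through this form. -/
lemma isSemisimple_of_iSup_range {ι : Type*} {U : ι → Type*} [∀ i, AddCommGroup (U i)]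
    [∀ i, Module ℂ (U i)] (τ : ∀ i, Representation ℂ G (U i))
    (hτ : ∀ i, (τ i).IsSemisimpleRepresentation) (f : ∀ i, U i →ₗ[ℂ] E)
    (hf : ∀ i g x, f i (τ i g x) = ρ g (f i x)) (h : ⨆ i, LinearMap.range (f i) = ⊤) :
    ρ.IsSemisimpleRepresentation := by
  rw [Representation.isSemisimpleRepresentation_iff_isSemisimpleModule_asModule]
  let φ (i) : Representation.IntertwiningMap (τ i) ρ :=
    ⟨f i, fun g => LinearMap.ext fun x => hf i g x⟩
  let ψ (i) := Representation.IntertwiningMap.equivLinearMapAsModule (τ i) ρ (φ i)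
  refine isSemisimpleModule_of_isSemisimpleModule_submodule (s := Set.univ)
    (p := fun i => LinearMap.range (ψ i)) (fun i _ => ?_) ?_
  · have := (Representation.isSemisimpleRepresentation_iff_isSemisimpleModule_asModule (τ i)).1
      (hτ i)
    exact IsSemisimpleModule.range _
  · simp only [Set.mem_univ, iSup_pos]
    let P := ⨆ i, LinearMap.range (ψ i)
    have hP : (Subrepresentation.ofSubmodule' P).toSubmodule = ⊤ := by
      rw [eq_top_iff, ← h]
      refine iSup_le fun i => ?_
      rintro _ ⟨x, rfl⟩
      exact (le_iSup (fun i => LinearMap.range (ψ i)) i) ⟨x, rfl⟩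
    rw [eq_top_iff]
    intro x _
    exact hP.ge (Submodule.mem_top (x := x))

lemma iSup_irreducible_eq_top (h : ρ.IsSemisimpleRepresentation) :
    ⨆ S : {S : Subrepresentation ρ // S.toRepresentation.IsIrreducible},
      S.1.toSubmodule = ⊤ := by
  have := (Representation.isSemisimpleRepresentation_iff_isSemisimpleModule_asModule ρ).1 h
  have htop := IsSemisimpleModule.sSup_simples_eq_top (MonoidAlgebra ℂ G) ρ.asModule
  set P := ⨆ S : {S : Subrepresentation ρ // S.toRepresentation.IsIrreducible}, S.1.toSubmodule
    with hP
  have hPinv (g : G) (x : E) (hx : x ∈ P) : ρ g x ∈ P := by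
    have : P ≤ P.comap (ρ g) := iSup_le fun S x hx =>
      (le_iSup (fun S : {S : Subrepresentation ρ // S.toRepresentation.IsIrreducible} =>
        S.1.toSubmodule) S) (S.1.apply_mem_toSubmodule g hx)
    exact this hx
  let P' : Submodule (MonoidAlgebra ℂ G) ρ.asModule :=
    Subrepresentation.asSubmodule (ρ := ρ) ⟨P, hPinv⟩
  have h1 : (⊤ : Submodule (MonoidAlgebra ℂ G) ρ.asModule) ≤ P' := by
    rw [← htop]
    refine sSup_le fun m hm => ?_
    let S : Subrepresentation ρ := Subrepresentation.ofSubmodule' m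
    have hm' : IsAtom m := isSimpleModule_iff_isAtom.1 hm
    have hS : S.toRepresentation.IsIrreducible := by
      rw [isIrreducible_iff]
      constructor
      · have hne := (Submodule.ne_bot_iff m).1 hm'.1
        obtain ⟨x, hx, hx0⟩ := hne
        exact ⟨⟨x, hx⟩, 0, fun he => hx0 (congrArg Subtype.val he)⟩
      · intro T hT
        let T' : Subrepresentation ρ := ⟨T.map S.toSubmodule.subtype, by
          rintro g _ ⟨x, hx, rfl⟩
          exact ⟨S.toRepresentation g x, hT g x hx, rfl⟩⟩
        have hle : T'.asSubmodule ≤ m := by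
          rintro _ ⟨x, hx, rfl⟩
          exact x.2
        rcases hm'.le_iff.1 hle with h0 | h0
        · left
          rw [eq_bot_iff]
          intro x hx
          have hx' : (x : E) ∈ T'.asSubmodule := ⟨x, hx, rfl⟩
          rw [h0] at hx'
          have hx0 : (x : E) = 0 := (Submodule.mem_bot (M := ρ.asModule) _).1 hx'
          exact (Submodule.mem_bot ℂ).2 (Subtype.ext hx0)
        · right
          rw [eq_top_iff]
          intro x _
          have hx' : (x : E) ∈ T'.asSubmodule := h0.ge x.2
          obtain ⟨y, hy, hyx⟩ := hx'
          rwa [Subtype.ext hyx] at hy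
    intro x hx
    exact (le_iSup (fun S : {S : Subrepresentation ρ // S.toRepresentation.IsIrreducible} =>
        S.1.toSubmodule) ⟨S, hS⟩) hx
  rw [eq_top_iff]
  intro x _
  exact h1 (Submodule.mem_top (M := ρ.asModule) (x := x))

/-- Burnside's theorem. -/
lemma span_range_eq_top [Module.Finite ℂ E] (h : ρ.IsIrreducible) :
    Submodule.span ℂ (Set.range ρ) = ⊤ := by
  -- By Schur's lemma the commutant consists of scalars, so every linear `f` commutes with it; the
  -- density theorem then realises `f` by an element of the group algebra.
  have hb := IsSimpleModule.algebraMap_end_bijective_of_isAlgClosed (A := MonoidAlgebra ℂ G)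
    (V := ρ.asModule) ℂ
  have : Module.Finite (Module.End (MonoidAlgebra ℂ G) ρ.asModule) ρ.asModule :=
    Module.Finite.of_restrictScalars_finite ℂ _ _
  rw [eq_top_iff]
  intro f _
  let f' : Module.End (Module.End (MonoidAlgebra ℂ G) ρ.asModule) ρ.asModule :=
    { toFun := f
      map_add' := map_add f
      map_smul' := fun g x => by
        obtain ⟨c, rfl⟩ := hb.2 g
        exact map_smul f c x }
  obtain ⟨r, hr⟩ := Module.Finite.toModuleEnd_moduleEnd_surjective
    (R := MonoidAlgebra ℂ G) (M := ρ.asModule) f'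
  have hr' : ρ.asAlgebraHom r = f := LinearMap.ext fun x => by
    have h1 := LinearMap.congr_fun hr x
    exact (Representation.asModuleEquiv_map_smul ρ r x).symm.trans h1
  rw [← hr']
  clear hr hr'
  induction r using MonoidAlgebra.induction_linear with
  | zero => rw [map_zero]; exact Submodule.zero_mem _
  | add x y hx hy => rw [map_add]; exact Submodule.add_mem _ hx hy
  | single g c =>
    rw [Representation.asAlgebraHom_single]
    exact Submodule.smul_mem _ _ (Submodule.subset_span ⟨g, rfl⟩)

/-- The external tensor product of two representations. -/
def extTensor : Representation ℂ (G × H) (E ⊗[ℂ] F) :=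
  Representation.tprod (ρ.comp (MonoidHom.fst G H)) (σ.comp (MonoidHom.snd G H))

lemma extTensor_apply (g : G) (h : H) :
    extTensor ρ σ (g, h) = TensorProduct.map (ρ g) (σ h) := rfl

/-- The vectors `w` with `E ⊗ w ⊆ S`. -/
def tensorSection (S : Submodule ℂ (E ⊗[ℂ] F)) : Submodule ℂ F :=
  ⨅ v : E, S.comap (TensorProduct.mk ℂ E F v)

lemma mem_tensorSection {S : Submodule ℂ (E ⊗[ℂ] F)} {w : F} :
    w ∈ tensorSection S ↔ ∀ v : E, v ⊗ₜ w ∈ S := by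
  simp [tensorSection, Submodule.mem_iInf]

/-- By Burnside's theorem `S` is stable under all `f ⊗ id`. Operators `f` of rank one extract the
coefficients of `x` in a basis of `E` and show that each of them tensors with all of `E` into `S`.
-/
lemma mem_of_tensorSection [Module.Finite ℂ E] (h : ρ.IsIrreducible)
    {S : Submodule ℂ (E ⊗[ℂ] F)}
    (hS : ∀ g, ∀ x ∈ S, TensorProduct.map (ρ g) LinearMap.id x ∈ S) {x : E ⊗[ℂ] F} (hx : x ∈ S) :
    ∃ (n : ℕ) (v : Fin n → E) (w : Fin n → F), (∀ i, w i ∈ tensorSection S) ∧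
      x = ∑ i, v i ⊗ₜ w i := by
  have key (f : Module.End ℂ E) (y : E ⊗[ℂ] F) (hy : y ∈ S) :
      TensorProduct.map f LinearMap.id y ∈ S := by
    have hf : f ∈ Submodule.span ℂ (Set.range ρ) := span_range_eq_top ρ h ▸ Submodule.mem_top
    induction hf using Submodule.span_induction with
    | mem f hf => obtain ⟨g, rfl⟩ := hf; exact hS g y hy
    | zero => rw [TensorProduct.map_zero_left]; exact S.zero_mem
    | add f g _ _ hf hg => rw [TensorProduct.map_add_left]; exact S.add_mem hf hg
    | smul c f _ hf => rw [TensorProduct.map_smul_left]; exact S.smul_mem c hf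
  let b := Module.finBasis ℂ E
  let slice (l : Module.Dual ℂ E) : E ⊗[ℂ] F →ₗ[ℂ] F :=
    (TensorProduct.lid ℂ F).toLinearMap ∘ₗ TensorProduct.map l LinearMap.id
  have hslice (v : E) (l : Module.Dual ℂ E) (y : E ⊗[ℂ] F) :
      TensorProduct.map (l.smulRight v) LinearMap.id y = v ⊗ₜ slice l y := by
    induction y with
    | zero => simp
    | tmul e f => simp [slice, TensorProduct.smul_tmul]
    | add y z hy hz => simp only [map_add, hy, hz, TensorProduct.tmul_add]
  refine ⟨_, b, fun i => slice (b.coord i) x, fun i => ?_, ?_⟩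
  · rw [mem_tensorSection]
    intro v
    rw [← hslice]
    exact key _ x hx
  · clear hx
    induction x with
    | zero => simp
    | tmul e f =>
      conv_lhs => rw [← b.sum_repr e, TensorProduct.sum_tmul]
      refine Finset.sum_congr rfl fun i _ => ?_
      simp [slice, TensorProduct.smul_tmul]
    | add y z hy hz =>
      simp only [map_add, TensorProduct.tmul_add, Finset.sum_add_distrib, ← hy, ← hz]

/-- An invariant subspace is `E ⊗ F'`, and `F'` is invariant under the second group, hence `0` or
everything. -/
lemma extTensor_isIrreducible [Module.Finite ℂ E] (hρ : ρ.IsIrreducible)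
    (hσ : σ.IsIrreducible) : (extTensor ρ σ).IsIrreducible := by
  have hE := ((isIrreducible_iff ρ).1 hρ).1
  obtain ⟨hF, hσ'⟩ := (isIrreducible_iff σ).1 hσ
  rw [isIrreducible_iff]
  refine ⟨inferInstance, fun S hS => ?_⟩
  have hS1 (g : G) (x) (hx : x ∈ S) : TensorProduct.map (ρ g) LinearMap.id x ∈ S := by
    have := hS (g, 1) x hx
    rwa [extTensor_apply, map_one] at this
  have hS2 (g : H) (w) (hw : w ∈ tensorSection S) : σ g w ∈ tensorSection S := by
    rw [mem_tensorSection] at hw ⊢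
    intro v
    have := hS (1, g) _ (hw v)
    rwa [extTensor_apply, map_one, TensorProduct.map_tmul] at this
  rcases hσ' _ hS2 with h | h
  · left
    rw [eq_bot_iff]
    intro x hx
    obtain ⟨n, v, w, hw, rfl⟩ := mem_of_tensorSection ρ hρ hS1 hx
    rw [h] at hw
    rw [Submodule.mem_bot]
    exact Finset.sum_eq_zero fun i _ => by
      rw [(Submodule.mem_bot ℂ).1 (hw i), TensorProduct.tmul_zero]
  · right
    rw [eq_top_iff, ← TensorProduct.span_tmul_eq_top, Submodule.span_le]
    rintro _ ⟨v, w, rfl⟩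
    exact mem_tensorSection.1 (h ▸ Submodule.mem_top : w ∈ tensorSection S) v

lemma extTensor_isSemisimple [Module.Finite ℂ E] (hρ : ρ.IsSemisimpleRepresentation)
    (hσ : σ.IsSemisimpleRepresentation) : (extTensor ρ σ).IsSemisimpleRepresentation := by
  let I := {S : Subrepresentation ρ // S.toRepresentation.IsIrreducible}
  let J := {S : Subrepresentation σ // S.toRepresentation.IsIrreducible}
  refine isSemisimple_of_iSup_range (ι := I × J) (extTensor ρ σ)
    (fun s => extTensor s.1.1.toRepresentation s.2.1.toRepresentation) (fun s => ?_)
    (fun s => TensorProduct.map s.1.1.toSubmodule.subtype s.2.1.toSubmodule.subtype)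
    (fun s g x => ?_) ?_
  · have := extTensor_isIrreducible _ _ s.1.2 s.2.2
    infer_instance
  · induction x with
    | zero => simp
    | tmul v w => rfl
    | add x y hx hy => simp only [map_add, hx, hy]
  · set P := ⨆ s : I × J, LinearMap.range
      (TensorProduct.map s.1.1.toSubmodule.subtype s.2.1.toSubmodule.subtype) with hP
    have h1 (s : I) (v : E) (hv : v ∈ s.1.toSubmodule) (w : F) : v ⊗ₜ w ∈ P := by
      have : ⊤ ≤ P.comap (TensorProduct.mk ℂ E F v) := by
        rw [← iSup_irreducible_eq_top σ hσ]
        refine iSup_le fun t w hw => ?_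
        exact le_iSup (fun s : I × J => LinearMap.range
          (TensorProduct.map s.1.1.toSubmodule.subtype s.2.1.toSubmodule.subtype)) (s, t)
          ⟨(⟨v, hv⟩ : s.1.toSubmodule) ⊗ₜ (⟨w, hw⟩ : t.1.toSubmodule), rfl⟩
      exact this Submodule.mem_top
    have h2 (w : F) (v : E) : v ⊗ₜ w ∈ P := by
      have : ⊤ ≤ P.comap ((TensorProduct.mk ℂ E F).flip w) := by
        rw [← iSup_irreducible_eq_top ρ hρ]
        exact iSup_le fun s v hv => h1 s v hv w
      exact this Submodule.mem_top
    rw [eq_top_iff, ← TensorProduct.span_tmul_eq_top, Submodule.span_le]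
    rintro _ ⟨v, w, rfl⟩
    exact h2 w v

end Representations

/-! ### Transfer between representations, possibly of different groups -/

section RepresentationTransfer

variable {G G' E E' : Type*} [Monoid G] [Monoid G'] [AddCommGroup E] [Module ℂ E]
  [AddCommGroup E'] [Module ℂ E'] {ρ : Representation ℂ G E} {ρ' : Representation ℂ G' E'}

/-- Semisimplicity depends only on the set of operators, so no homomorphism between the groups is
asked for. -/
lemma isSemisimple_of_linearEquiv (e : E ≃ₗ[ℂ] E')
    (h₁ : ∀ g', ∃ g, ∀ x, e (ρ g x) = ρ' g' (e x)) (h₂ : ∀ g, ∃ g', ∀ x, e (ρ g x) = ρ' g' (e x))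
    (h : ρ.IsSemisimpleRepresentation) : ρ'.IsSemisimpleRepresentation := by
  rw [isSemisimple_iff] at h ⊢
  intro S hS
  obtain ⟨T, hT, hST⟩ := h (S.comap e.toLinearMap) fun g x hx => by
    obtain ⟨g', hg'⟩ := h₂ g
    rw [Submodule.mem_comap, LinearEquiv.coe_coe, hg']
    exact hS g' _ hx
  refine ⟨T.map e.toLinearMap, ?_, ?_⟩
  · rintro g' _ ⟨x, hx, rfl⟩
    obtain ⟨g, hg⟩ := h₁ g'
    exact ⟨ρ g x, hT g x hx, hg x⟩
  · have h' := (OrderIso.isCompl_iff (Submodule.orderIsoMapComap e)).1 hST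
    have hmap : (S.comap e.toLinearMap).map e.toLinearMap = S :=
      Submodule.map_comap_eq_of_surjective e.surjective S
    rw [← hmap]
    exact h'

lemma isIrreducible_of_linearEquiv (e : E ≃ₗ[ℂ] E')
    (h₂ : ∀ g, ∃ g', ∀ x, e (ρ g x) = ρ' g' (e x))
    (h : ρ.IsIrreducible) : ρ'.IsIrreducible := by
  rw [isIrreducible_iff] at h ⊢
  obtain ⟨hE, h⟩ := h
  refine ⟨e.symm.toEquiv.nontrivial, fun S hS => ?_⟩
  have hmap : (S.comap e.toLinearMap).map e.toLinearMap = S :=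
    Submodule.map_comap_eq_of_surjective e.surjective S
  rcases h (S.comap e.toLinearMap) (fun g x hx => by
    obtain ⟨g', hg'⟩ := h₂ g
    rw [Submodule.mem_comap, LinearEquiv.coe_coe, hg']
    exact hS g' _ hx) with h0 | h0
  · left
    rw [← hmap, h0, Submodule.map_bot]
  · right
    rw [← hmap, h0, Submodule.map_top]
    exact LinearEquiv.range e

end RepresentationTransfer

/-! ### Irreducible representations of a product -/

section Decomposition

variable {G H E : Type*} [Monoid G] [Monoid H] [AddCommGroup E] [Module ℂ E]

lemma exists_irreducible_subrepresentation [Module.Finite ℂ E] [Nontrivial E]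
    (ρ : Representation ℂ G E) : ∃ S : Subrepresentation ρ, S.toRepresentation.IsIrreducible := by
  obtain ⟨S, ⟨hS, hS0⟩, hmin⟩ := (wellFounded_lt (α := Submodule ℂ E)).has_min
    {S | (∀ g, ∀ x ∈ S, ρ g x ∈ S) ∧ S ≠ ⊥} ⟨⊤, fun _ _ _ => Submodule.mem_top, top_ne_bot⟩
  refine ⟨⟨S, hS⟩, (isIrreducible_iff _).2 ⟨Submodule.nontrivial_iff_ne_bot.2 hS0, fun T hT => ?_⟩⟩
  by_cases hT0 : T = ⊥
  · exact Or.inl hT0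
  right
  have h1 : T.map S.subtype ≤ S := Submodule.map_subtype_le S T
  have h2 := hmin (T.map S.subtype) ⟨?_, ?_⟩
  · have h3 : T.map S.subtype = S := h1.eq_of_not_lt h2
    rw [eq_top_iff]
    intro x _
    obtain ⟨y, hy, hyx⟩ := h3.ge x.2
    rwa [Subtype.ext hyx] at hy
  · rintro g _ ⟨x, hx, rfl⟩
    exact ⟨_, hT g x hx, rfl⟩
  · rwa [Ne, (Submodule.map_injective_of_injective S.injective_subtype).eq_iff'
      (Submodule.map_bot _)]

variable {U : Type*} [AddCommGroup U] [Module ℂ U] (τ : Representation ℂ (G × H) E)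
  (ρ : Representation ℂ G U)

/-- The maps from `U` to `E` that commute with the first factor. -/
def multiplicitySpace : Submodule ℂ (U →ₗ[ℂ] E) where
  carrier := {f | ∀ g x, f (ρ g x) = τ (g, 1) (f x)}
  add_mem' ha hb g x := by simp [ha g x, hb g x]
  zero_mem' g x := by simp
  smul_mem' c f hf g x := by simp [hf g x]

/-- The second factor acts on the multiplicity space. -/
def multiplicityRepresentation : Representation ℂ H (multiplicitySpace τ ρ) where
  toFun h := (LinearMap.llcomp ℂ U E E (τ (1, h))).restrict fun f hf g x => by
    change τ (1, h) (f (ρ g x)) = τ (g, 1) (τ (1, h) (f x))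
    rw [hf g x, ← Module.End.mul_apply, ← Module.End.mul_apply, ← map_mul, ← map_mul]
    simp
  map_one' := by
    ext f x
    exact congrArg (fun φ : E →ₗ[ℂ] E => φ (f.1 x)) (map_one τ)
  map_mul' h h' := by
    ext f x
    have h1 : ((1, h * h') : G × H) = (1, h) * (1, h') := by simp
    exact congrArg (fun φ : E →ₗ[ℂ] E => φ (f.1 x)) ((congrArg τ h1).trans (map_mul τ _ _))

lemma multiplicityRepresentation_apply (h : H) (f : multiplicitySpace τ ρ) (x : U) :
    (multiplicityRepresentation τ ρ h f).1 x = τ (1, h) (f.1 x) := rfl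

/-- The evaluation map. -/
def multiplicityEval : U ⊗[ℂ] multiplicitySpace τ ρ →ₗ[ℂ] E :=
  TensorProduct.lift (multiplicitySpace τ ρ).subtype.flip

lemma multiplicityEval_tmul (x : U) (f : multiplicitySpace τ ρ) :
    multiplicityEval τ ρ (x ⊗ₜ f) = f.1 x := rfl

lemma multiplicityEval_extTensor (g : G) (h : H) (x) :
    multiplicityEval τ ρ (extTensor ρ (multiplicityRepresentation τ ρ) (g, h) x) =
      τ (g, h) (multiplicityEval τ ρ x) := by
  induction x with
  | zero => simp
  | tmul v f =>
    rw [extTensor_apply, TensorProduct.map_tmul, multiplicityEval_tmul, multiplicityEval_tmul,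
      multiplicityRepresentation_apply, f.2, ← Module.End.mul_apply, ← map_mul]
    simp
  | add x y hx hy => simp only [map_add, hx, hy]

/-- The kernel is stable under the first factor, so its elements are sums of `v ⊗ f` with all of `U
⊗ f` in the kernel; such an `f` vanishes everywhere. -/
lemma multiplicityEval_injective [Module.Finite ℂ U] (hρ : ρ.IsIrreducible) :
    Function.Injective (multiplicityEval τ ρ) := by
  rw [← LinearMap.ker_eq_bot, eq_bot_iff]
  intro x hx
  obtain ⟨n, v, f, hf, rfl⟩ := mem_of_tensorSection ρ hρ (S := LinearMap.ker (multiplicityEval τ ρ))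
    (fun g y hy => by
      have h := multiplicityEval_extTensor τ ρ g 1 y
      rw [extTensor_apply, map_one, LinearMap.mem_ker.1 hy, map_zero] at h
      exact h) hx
  rw [Submodule.mem_bot]
  refine Finset.sum_eq_zero fun i _ => ?_
  have h0 : f i = 0 := Subtype.ext (LinearMap.ext fun x => mem_tensorSection.1 (hf i) x)
  rw [h0, TensorProduct.tmul_zero]

/-- A finite-dimensional irreducible representation of a product is an external tensor product of
irreducible representations. -/
theorem exists_extTensor_of_isIrreducible {E : Type} [AddCommGroup E] [Module ℂ E]
    [Module.Finite ℂ E] (τ : Representation ℂ (G × H) E) (hτ : τ.IsIrreducible) :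
    ∃ (U M : Type) (_ : AddCommGroup U) (_ : Module ℂ U) (_ : AddCommGroup M) (_ : Module ℂ M)
      (_ : Module.Finite ℂ U) (_ : Module.Finite ℂ M) (ρ : Representation ℂ G U)
      (σ : Representation ℂ H M) (e : U ⊗[ℂ] M ≃ₗ[ℂ] E), ρ.IsIrreducible ∧ σ.IsIrreducible ∧
        ∀ g h x, e (extTensor ρ σ (g, h) x) = τ (g, h) (e x) := by
  obtain ⟨hE, hτ'⟩ := (isIrreducible_iff τ).1 hτ
  -- `U` is an irreducible subspace for the first factor, and `M` its multiplicity space, which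
  -- contains the inclusion `i` and so is nonzero.
  obtain ⟨S, hS⟩ := exists_irreducible_subrepresentation (τ.comp (MonoidHom.inl G H))
  obtain ⟨hU, -⟩ := (isIrreducible_iff _).1 hS
  let ρ := S.toRepresentation
  obtain ⟨u, hu⟩ := exists_ne (0 : S.toSubmodule)
  obtain ⟨l, hl⟩ := Module.Projective.exists_dual_eq_one ℂ hu
  have hinj := multiplicityEval_injective τ ρ hS
  let i : multiplicitySpace τ ρ := ⟨S.toSubmodule.subtype, fun g x => rfl⟩
  have htop (P : Submodule ℂ (S.toSubmodule ⊗[ℂ] multiplicitySpace τ ρ)) (hP0 : P ≠ ⊥)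
      (hP : ∀ g h, ∀ x ∈ P, extTensor ρ (multiplicityRepresentation τ ρ) (g, h) x ∈ P) :
      P.map (multiplicityEval τ ρ) = ⊤ := by
    refine (hτ' (P.map (multiplicityEval τ ρ)) ?_).resolve_left ?_
    · rintro ⟨g, h⟩ _ ⟨x, hx, rfl⟩
      exact ⟨_, hP g h x hx, multiplicityEval_extTensor τ ρ g h x⟩
    · rwa [(Submodule.map_injective_of_injective hinj).eq_iff' (Submodule.map_bot _)]
  have hi : u ⊗ₜ[ℂ] i ≠ 0 := by
    intro h
    have h' := congrArg (multiplicityEval τ ρ) h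
    rw [map_zero] at h'
    exact hu (Subtype.ext h')
  have hsurj : Function.Surjective (multiplicityEval τ ρ) := by
    rw [← LinearMap.range_eq_top, LinearMap.range_eq_map]
    refine htop ⊤ (fun h => hi ?_) fun _ _ _ _ => Submodule.mem_top
    exact (Submodule.mem_bot ℂ).1 (h ▸ Submodule.mem_top)
  -- For an invariant `T ≠ 0`, the image of `U ⊗ T` is all of `E`, so by injectivity `u ⊗ m` lies in
  -- `U ⊗ T`; contracting with `l`, where `l u = 1`, puts `m` in `T`.
  have hirr : (multiplicityRepresentation τ ρ).IsIrreducible := by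
    rw [isIrreducible_iff]
    refine ⟨⟨i, 0, fun h => hi (by rw [h, TensorProduct.tmul_zero])⟩, fun T hT => ?_⟩
    by_cases hT0 : T = ⊥
    · exact Or.inl hT0
    right
    obtain ⟨f, hf, hf0⟩ := (Submodule.ne_bot_iff T).1 hT0
    let P : Submodule ℂ (S.toSubmodule ⊗[ℂ] multiplicitySpace τ ρ) :=
      LinearMap.range (TensorProduct.map LinearMap.id T.subtype)
    let r : S.toSubmodule ⊗[ℂ] multiplicitySpace τ ρ →ₗ[ℂ] multiplicitySpace τ ρ :=
      (TensorProduct.lid ℂ _).toLinearMap ∘ₗ TensorProduct.map l LinearMap.id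
    have hr (m) : r (u ⊗ₜ m) = m := by simp [r, hl]
    have hPtop : P.map (multiplicityEval τ ρ) = ⊤ := by
      refine htop P (fun h => hf0 ?_) ?_
      · have h1 : u ⊗ₜ f ∈ P := ⟨u ⊗ₜ ⟨f, hf⟩, rfl⟩
        rw [h, Submodule.mem_bot] at h1
        rw [← hr f, h1, map_zero]
      · rintro g h _ ⟨x, rfl⟩
        induction x with
        | zero => simp
        | tmul v m => exact ⟨ρ g v ⊗ₜ ⟨_, hT h m.1 m.2⟩, rfl⟩
        | add x y hx hy =>
          rw [map_add, map_add]
          exact P.add_mem hx hy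
    rw [eq_top_iff]
    intro m _
    obtain ⟨y, ⟨x, rfl⟩, hy⟩ := hPtop.ge (Submodule.mem_top (x := multiplicityEval τ ρ (u ⊗ₜ m)))
    rw [← hr m, ← hinj hy]
    clear hy
    induction x with
    | zero => simp
    | tmul v m =>
      have : r (v ⊗ₜ m.1) = l v • m.1 := by simp [r]
      exact this ▸ T.smul_mem _ m.2
    | add x y hx hy =>
      rw [map_add, map_add]
      exact T.add_mem hx hy
  exact ⟨S.toSubmodule, multiplicitySpace τ ρ, inferInstance, inferInstance, inferInstance,
    inferInstance, inferInstance, inferInstance, ρ, multiplicityRepresentation τ ρ,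
    LinearEquiv.ofBijective _ ⟨hinj, hsurj⟩, hS, hirr, multiplicityEval_extTensor τ ρ⟩

end Decomposition

section LocalSystems

variable {X : Type u} [TopologicalSpace X]

/-! ### Cochains and maps of local systems -/

lemma isExactAt_of_subsingleton {M : CosimplicialSpace.{u}} (h : ∀ m, Subsingleton (M.obj m))
    (n : ℕ) : IsExactAt M n := by
  cases n with
  | zero => exact fun x _ => Subsingleton.elim _ _
  | succ n => exact fun x _ => ⟨0, Subsingleton.elim _ _⟩

/-- The map of cochains induced by a map of local systems. -/
def cochainSpaceMap {V W : LocalSystem X} (f : V ⟶ W) : cochainSpace V ⟶ cochainSpace W where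
  app n := ModuleCat.ofHom (LinearMap.pi fun σ : C(Simplex n, X) =>
    (f.app ⟨σ (vertexZero n)⟩).hom ∘ₗ LinearMap.proj σ)
  naturality {m n} g := by
    refine ModuleCat.hom_ext (LinearMap.ext fun (c : SingularCochain V m) => funext fun σ => ?_)
    exact congrArg (fun φ => φ.hom (c (σ.comp (simplexMap g)))) (f.naturality
      ((FundamentalGroupoid.map σ).map (simplexPath (simplexMap g (vertexZero m)) (vertexZero n))))

lemma cochainSpaceMap_comp_eq_id {V W : LocalSystem X} (f : V ⟶ W) (g : W ⟶ V) (h : f ≫ g = 𝟙 V) :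
    cochainSpaceMap f ≫ cochainSpaceMap g = 𝟙 (cochainSpace V) := by
  refine NatTrans.ext (funext fun n => ModuleCat.hom_ext (LinearMap.ext
    fun (c : SingularCochain V n) => funext fun σ => ?_))
  exact congrArg (fun φ => (φ.app ⟨σ (vertexZero n)⟩).hom (c σ)) h

lemma isExactAt_cochainSpace_congr {V W : LocalSystem X} (e : V ≅ W) (k : ℕ) :
    IsExactAt (cochainSpace V) k ↔ IsExactAt (cochainSpace W) k :=
  isExactAt_congr ⟨cochainSpaceMap e.hom, cochainSpaceMap e.inv,
    cochainSpaceMap_comp_eq_id _ _ e.hom_inv_id, cochainSpaceMap_comp_eq_id _ _ e.inv_hom_id⟩ k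

lemma biprod_total_apply (V W : LocalSystem X) (z : FundamentalGroupoid X) (v : (V ⊞ W).obj z) :
    ((biprod.inl : V ⟶ V ⊞ W).app z).hom (((biprod.fst : V ⊞ W ⟶ V).app z).hom v) +
      ((biprod.inr : W ⟶ V ⊞ W).app z).hom (((biprod.snd : V ⊞ W ⟶ W).app z).hom v) = v :=
  congrArg (fun φ => (φ.app z).hom v) (biprod.total (X := V) (Y := W))

lemma isExactAt_biprod_iff (V W : LocalSystem X) (k : ℕ) :
    IsExactAt (cochainSpace (V ⊞ W)) k ↔
      IsExactAt (cochainSpace V) k ∧ IsExactAt (cochainSpace W) k :=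
  isExactAt_iff_of_binary (cochainSpaceMap biprod.inl) (cochainSpaceMap biprod.fst)
    (cochainSpaceMap biprod.inr) (cochainSpaceMap biprod.snd)
    (cochainSpaceMap_comp_eq_id _ _ biprod.inl_fst) (cochainSpaceMap_comp_eq_id _ _ biprod.inr_snd)
    (fun _ _ => funext fun _ => biprod_total_apply V W _ _) k

/-- The fibres of a direct sum. -/
def biprodFibreEquiv (V W : LocalSystem X) (z : FundamentalGroupoid X) :
    (V ⊞ W).obj z ≃ₗ[ℂ] V.obj z × W.obj z :=
  LinearEquiv.ofLinearMap
    (((biprod.fst : V ⊞ W ⟶ V).app z).hom.prod ((biprod.snd : V ⊞ W ⟶ W).app z).hom)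
    (((biprod.inl : V ⟶ V ⊞ W).app z).hom.coprod ((biprod.inr : W ⟶ V ⊞ W).app z).hom)
    (by
      have h₁ (v) := congrArg (fun φ => (φ.app z).hom v) (biprod.inl_fst (X := V) (Y := W))
      have h₂ (v) := congrArg (fun φ => (φ.app z).hom v) (biprod.inl_snd (X := V) (Y := W))
      have h₃ (v) := congrArg (fun φ => (φ.app z).hom v) (biprod.inr_fst (X := V) (Y := W))
      have h₄ (v) := congrArg (fun φ => (φ.app z).hom v) (biprod.inr_snd (X := V) (Y := W))
      refine LinearMap.prod_ext ?_ ?_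
      · rw [LinearMap.comp_assoc, LinearMap.coprod_inl]
        exact LinearMap.ext fun v => Prod.ext (h₁ v) (h₂ v)
      · rw [LinearMap.comp_assoc, LinearMap.coprod_inr]
        exact LinearMap.ext fun v => Prod.ext (h₃ v) (h₄ v))
    (LinearMap.ext fun v => biprod_total_apply V W z v)

lemma biprodFibreEquiv_map (V W : LocalSystem X) {y z : FundamentalGroupoid X} (γ : y ⟶ z)
    (v : (V ⊞ W).obj y) : biprodFibreEquiv V W z (((V ⊞ W).map γ).hom v) =
      ((V.map γ).hom (biprodFibreEquiv V W y v).1, (W.map γ).hom (biprodFibreEquiv V W y v).2) :=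
  Prod.ext (congrArg (fun φ => φ.hom v) ((biprod.fst : V ⊞ W ⟶ V).naturality γ))
    (congrArg (fun φ => φ.hom v) ((biprod.snd : V ⊞ W ⟶ W).naturality γ))

/-! ### Monodromy -/

/-- `V` is irreducible: its monodromy representations are. -/
def LocalSystem.IsIrreducible (V : LocalSystem X) : Prop :=
  ∀ x : X, (V.monodromy x).IsIrreducible

lemma LocalSystem.IsSemisimple.congr {V W : LocalSystem X} (e : V ≅ W) (h : V.IsSemisimple) :
    W.IsSemisimple := fun x => by
  have he (g : FundamentalGroup X x) (v : V.obj ⟨x⟩) :=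
    congrArg (fun φ => φ.hom v) (e.hom.naturality (X := ⟨x⟩) (Y := ⟨x⟩) g)
  exact isSemisimple_of_linearEquiv (e.app ⟨x⟩).toLinearEquiv (fun g => ⟨g, he g⟩)
    (fun g => ⟨g, he g⟩) (h x)

lemma LocalSystem.HasRank.congr {V W : LocalSystem X} (e : V ≅ W) {n : ℕ} (h : V.HasRank n) :
    W.HasRank n := fun x => by
  rw [← h x]
  exact (e.app ⟨x⟩).toLinearEquiv.rank_eq.symm

lemma LocalSystem.IsIrreducible.isSemisimple {V : LocalSystem X} (h : V.IsIrreducible) :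
    V.IsSemisimple := fun x => by
  have := h x
  infer_instance

lemma LocalSystem.IsSemisimple.biprod {V W : LocalSystem X} (hV : V.IsSemisimple)
    (hW : W.IsSemisimple) : (V ⊞ W).IsSemisimple := fun x => by
  refine isSemisimple_of_iSup_range (ι := Bool)
    (U := fun b => (if b then V else W : LocalSystem X).obj ⟨x⟩) _
    (fun b => (if b then V else W : LocalSystem X).monodromy x) ?_
    (fun b => match b with
      | true => ((biprod.inl : V ⟶ V ⊞ W).app ⟨x⟩).hom
      | false => ((biprod.inr : W ⟶ V ⊞ W).app ⟨x⟩).hom) ?_ ?_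
  · rintro (_ | _)
    · exact hW x
    · exact hV x
  · rintro (_ | _) g v
    · exact congrArg (fun φ => φ.hom v)
        ((biprod.inr : W ⟶ V ⊞ W).naturality (X := ⟨x⟩) (Y := ⟨x⟩) g)
    · exact congrArg (fun φ => φ.hom v)
        ((biprod.inl : V ⟶ V ⊞ W).naturality (X := ⟨x⟩) (Y := ⟨x⟩) g)
  · rw [eq_top_iff]
    intro v _
    rw [← biprod_total_apply V W ⟨x⟩ v]
    exact Submodule.add_mem _ (Submodule.mem_iSup_of_mem true ⟨_, rfl⟩)
      (Submodule.mem_iSup_of_mem false ⟨_, rfl⟩)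

lemma LocalSystem.IsSemisimple.of_epi {V W : LocalSystem X} (hV : V.IsSemisimple) (f : V ⟶ W)
    (g : W ⟶ V) (hgf : g ≫ f = 𝟙 W) : W.IsSemisimple := fun x => by
  refine isSemisimple_of_iSup_range (ι := Unit) _ (fun _ => V.monodromy x) (fun _ => hV x)
    (fun _ => (f.app ⟨x⟩).hom) (fun _ γ v => congrArg (fun φ => φ.hom v)
      (f.naturality (X := ⟨x⟩) (Y := ⟨x⟩) γ)) ?_
  rw [iSup_const, LinearMap.range_eq_top]
  intro v
  exact ⟨(g.app ⟨x⟩).hom v, congrArg (fun φ => (φ.app ⟨x⟩).hom v) hgf⟩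

lemma LocalSystem.HasRank.biprod {V W : LocalSystem X} {m n : ℕ} (hV : V.HasRank m)
    (hW : W.HasRank n) : (V ⊞ W).HasRank (m + n) := fun x => by
  rw [(biprodFibreEquiv V W ⟨x⟩).rank_eq, rank_prod', hV x, hW x, Nat.cast_add]

lemma LocalSystem.HasRank.finite {V : LocalSystem X} {n : ℕ} (hV : V.HasRank n)
    (x : FundamentalGroupoid X) : Module.Finite ℂ (V.obj x) :=
  Module.finite_of_rank_eq_nat (hV x.as)

lemma LocalSystem.HasRank.right {V W : LocalSystem X} {m n : ℕ} (h : (V ⊞ W).HasRank n)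
    (hV : V.HasRank m) : W.HasRank (n - m) := fun x => by
  have h1 := (biprodFibreEquiv V W ⟨x⟩).rank_eq
  rw [rank_prod', h x, hV x] at h1
  have : Module.Finite ℂ (W.obj ⟨x⟩) := by
    rw [← Module.rank_lt_aleph0_iff]
    exact lt_of_le_of_lt (h1 ▸ self_le_add_left _ _) Cardinal.natCast_lt_aleph0
  rw [← Module.finrank_eq_rank ℂ (W.obj ⟨x⟩)] at h1 ⊢
  have h2 : n = m + Module.finrank ℂ (W.obj ⟨x⟩) := by exact_mod_cast h1
  rw [h2, Nat.add_sub_cancel_left]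

variable [PathConnectedSpace X]

/-- A path from `x` to `z`, as a morphism of the fundamental groupoid. -/
def pathFrom (x : X) (z : FundamentalGroupoid X) : FundamentalGroupoid.mk x ⟶ z :=
  Path.Homotopic.Quotient.mk (PathConnectedSpace.somePath x z.as)

/-- The isomorphism is carried to the other fibres along chosen paths from `x`. Naturality for `α`
is equivariance for the loop that closes `α` up with these paths. -/
lemma nonempty_iso_of_fibre_iso {V W : LocalSystem X} (x : X) (e : V.obj ⟨x⟩ ≃ₗ[ℂ] W.obj ⟨x⟩)
    (he : ∀ g v, e (V.monodromy x g v) = W.monodromy x g (e v)) : Nonempty (V ≅ W) := by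
  let E : V.obj ⟨x⟩ ≅ W.obj ⟨x⟩ := e.toModuleIso
  have hE (g : FundamentalGroupoid.mk x ⟶ FundamentalGroupoid.mk x) :
      V.map g ≫ E.hom = E.hom ≫ W.map g :=
    ModuleCat.hom_ext (LinearMap.ext fun v => he g v)
  refine ⟨NatIso.ofComponents (fun z => V.mapIso (asIso (pathFrom x z)).symm ≪≫ E ≪≫
    W.mapIso (asIso (pathFrom x z))) fun {y z} α => ?_⟩
  have h := hE (pathFrom x y ≫ α ≫ inv (pathFrom x z))
  simp only [Functor.map_comp, Category.assoc] at h
  simp only [Iso.trans_hom, Functor.mapIso_hom, Iso.symm_hom, asIso_inv, asIso_hom, Category.assoc]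
  rw [← cancel_epi (V.map (pathFrom x y)), reassoc_of% h, ← W.map_comp (inv _) (pathFrom x z),
    IsIso.inv_hom_id, W.map_id, Category.comp_id, ← V.map_comp_assoc _ (inv _), IsIso.hom_inv_id,
    V.map_id, Category.id_comp]

section BasePoint

variable (V : LocalSystem X) (x z : X)

/-- Transport along a path. -/
def fibreEquiv : V.obj ⟨x⟩ ≃ₗ[ℂ] V.obj ⟨z⟩ := (V.mapIso (asIso (pathFrom x ⟨z⟩))).toLinearEquiv

lemma fibreEquiv_monodromy (g : FundamentalGroup X x) (v : V.obj ⟨x⟩) :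
    fibreEquiv V x z (V.monodromy x g v) =
      V.monodromy z (inv (pathFrom x ⟨z⟩) ≫ g ≫ pathFrom x ⟨z⟩) (fibreEquiv V x z v) := by
  have h : V.map (X := ⟨x⟩) (Y := ⟨x⟩) g ≫ V.map (pathFrom x ⟨z⟩) =
      V.map (pathFrom x ⟨z⟩) ≫ V.map (inv (pathFrom x ⟨z⟩) ≫ g ≫ pathFrom x ⟨z⟩) := by
    rw [← V.map_comp, ← V.map_comp, IsIso.hom_inv_id_assoc]
  exact congrArg (fun φ => φ.hom v) h

variable {V} {x}

lemma isIrreducible_of_monodromy (h : (V.monodromy x).IsIrreducible) :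
    V.IsIrreducible := fun z =>
  isIrreducible_of_linearEquiv (fibreEquiv V x z) (fun g => ⟨_, fibreEquiv_monodromy V x z g⟩) h

lemma hasRank_of_finite [Module.Finite ℂ (V.obj ⟨x⟩)] :
    V.HasRank (Module.finrank ℂ (V.obj ⟨x⟩)) := fun z => by
  rw [Module.finrank_eq_rank]
  exact (fibreEquiv V x z).rank_eq.symm

end BasePoint

/-! ### The local system of a representation -/

variable {E F : Type} [AddCommGroup E] [Module ℂ E] [AddCommGroup F] [Module ℂ F] {x : X}
  (ρ : Representation ℂ (FundamentalGroup X x) E) (σ : Representation ℂ (FundamentalGroup X x) F)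

omit [PathConnectedSpace X] in
-- The order is reversed: multiplication of loops is composition of endomorphisms, whereas `≫` is
-- written in diagrammatic order.
lemma representation_comp (f g : FundamentalGroupoid.mk x ⟶ FundamentalGroupoid.mk x) :
    ρ (f ≫ g) = ρ g * ρ f :=
  MonoidHom.map_mul ρ g f

/-- The local system with a given monodromy representation. -/
def ofRepresentation : LocalSystem X where
  obj _ := ModuleCat.of ℂ E
  map {y z} α := ModuleCat.ofHom (ρ (pathFrom x y ≫ α ≫ inv (pathFrom x z)))
  map_id y := by
    rw [Category.id_comp, IsIso.hom_inv_id]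
    exact ModuleCat.hom_ext (map_one ρ)
  map_comp {y z w} α β := by
    refine ModuleCat.hom_ext (Eq.trans (congrArg ρ ?_) (representation_comp ρ
      (pathFrom x y ≫ α ≫ inv (pathFrom x z)) (pathFrom x z ≫ β ≫ inv (pathFrom x w))))
    simp

/-- The fibre at the base point of the local system of a representation. -/
def ofRepresentationFibre : (ofRepresentation ρ).obj ⟨x⟩ ≃ₗ[ℂ] E :=
  -- The chosen path from `x` to itself may be a nontrivial loop, so the identity of `E` need not be
  -- equivariant and is corrected by its action.
  LinearEquiv.ofLinearMap (ρ (pathFrom x ⟨x⟩)) (ρ (inv (pathFrom x ⟨x⟩)))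
    ((representation_comp ρ _ _).symm.trans (by rw [IsIso.inv_hom_id]; exact map_one ρ))
    ((representation_comp ρ _ _).symm.trans (by rw [IsIso.hom_inv_id]; exact map_one ρ))

lemma ofRepresentationFibre_monodromy (g : FundamentalGroup X x) (v) :
    ofRepresentationFibre ρ ((ofRepresentation ρ).monodromy x g v) =
      ρ g (ofRepresentationFibre ρ v) := by
  have h : ρ (pathFrom x ⟨x⟩) * ρ (pathFrom x ⟨x⟩ ≫ g ≫ inv (pathFrom x ⟨x⟩)) =
      ρ g * ρ (pathFrom x ⟨x⟩) := by
    rw [← representation_comp, ← representation_comp, Category.assoc, Category.assoc,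
      IsIso.inv_hom_id]
    exact congrArg ρ (congrArg _ (Category.comp_id _))
  exact LinearMap.congr_fun h v

lemma ofRepresentation_isIrreducible (h : ρ.IsIrreducible) :
    (ofRepresentation ρ).IsIrreducible := by
  have he (g : FundamentalGroup X x) (v) :
      (ofRepresentationFibre ρ).symm (ρ g v) = (ofRepresentation ρ).monodromy x g
        ((ofRepresentationFibre ρ).symm v) := by
    rw [LinearEquiv.symm_apply_eq, ofRepresentationFibre_monodromy, LinearEquiv.apply_symm_apply]
  exact isIrreducible_of_monodromy (isIrreducible_of_linearEquiv (ofRepresentationFibre ρ).symm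
    (fun g => ⟨g, he g⟩) h)

lemma nonempty_iso_biprod {V : LocalSystem X} (e : (E × F) ≃ₗ[ℂ] V.obj ⟨x⟩)
    (he : ∀ g v w, e (ρ g v, σ g w) = V.monodromy x g (e (v, w))) :
    Nonempty (ofRepresentation ρ ⊞ ofRepresentation σ ≅ V) := by
  refine nonempty_iso_of_fibre_iso x ((biprodFibreEquiv _ _ _).trans
    (((ofRepresentationFibre ρ).prodCongr (ofRepresentationFibre σ)).trans e)) fun g v => ?_
  have h := biprodFibreEquiv_map (ofRepresentation ρ) (ofRepresentation σ)
    (y := ⟨x⟩) (z := ⟨x⟩) g v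
  refine Eq.trans ?_ (he g _ _)
  refine congrArg e (Eq.trans (congrArg _ h) (Prod.ext ?_ ?_))
  · exact ofRepresentationFibre_monodromy ρ g _
  · exact ofRepresentationFibre_monodromy σ g _

/-- A semisimple local system with nonzero cohomology has an irreducible summand with nonzero
cohomology. -/
theorem exists_irreducible_summand {k : ℕ} {V : LocalSystem X} {n : ℕ} (hV : V.IsSemisimple)
    (hn : V.HasRank n) (hk : ¬ IsExactAt (cochainSpace V) k) :
    ∃ L W : LocalSystem X, L.IsIrreducible ∧ ¬ IsExactAt (cochainSpace L) k ∧
      Nonempty (L ⊞ W ≅ V) := by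
  obtain ⟨x⟩ := PathConnectedSpace.nonempty (X := X)
  induction n using Nat.strong_induction_on generalizing V with | _ n ih
  by_cases hirr : (V.monodromy x).IsIrreducible
  -- An irreducible `V` is its own summand, with zero complement.
  · obtain ⟨O, hO⟩ := HasZeroObject.zero (C := LocalSystem X)
    exact ⟨V, O, isIrreducible_of_monodromy hirr, hk, ⟨(isoBiprodZero hO).symm⟩⟩
  have hfin := hn.finite ⟨x⟩
  have hfr : Module.finrank ℂ (V.obj ⟨x⟩) = n := Module.finrank_eq_of_rank_eq (hn x)
  have hnt : Nontrivial (V.obj ⟨x⟩) := by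
    -- A zero fibre would make every cochain zero, against `hk`.
    rw [← not_subsingleton_iff_nontrivial]
    intro hs
    refine hk (isExactAt_of_subsingleton (fun m => ?_) k)
    have h (σ : C(Simplex m, X)) : Subsingleton (V.obj ⟨σ (vertexZero m)⟩) :=
      (fibreEquiv V x _).symm.toEquiv.subsingleton
    exact inferInstanceAs (Subsingleton (SingularCochain V m))
  rw [isIrreducible_iff] at hirr
  push Not at hirr
  obtain ⟨S, hS, hS0, hS1⟩ := hirr hnt
  obtain ⟨T, hT, hST⟩ := (isSemisimple_iff _).1 (hV x) S hS
  let ρ := (⟨S, hS⟩ : Subrepresentation (V.monodromy x)).toRepresentation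
  let σ := (⟨T, hT⟩ : Subrepresentation (V.monodromy x)).toRepresentation
  -- `V` splits into two semisimple pieces of smaller rank. One of them has cohomology, and the
  -- induction applies to it; the other piece joins the complement.
  obtain ⟨e⟩ := nonempty_iso_biprod ρ σ (Submodule.prodEquivOfIsCompl S T hST) fun g v w => by
    simp only [Submodule.coe_prodEquivOfIsCompl', map_add]
    rfl
  have hT1 : T ≠ ⊤ := fun h => hS0 (by simpa [h] using hST.inf_eq_bot)
  have hk' := mt (isExactAt_cochainSpace_congr e k).1 hk
  rw [isExactAt_biprod_iff, not_and_or] at hk'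
  have hV' := hV.congr e.symm
  have hA := hV'.of_epi biprod.fst biprod.inl biprod.inl_fst
  have hB := hV'.of_epi biprod.snd biprod.inr biprod.inr_snd
  have hrank {E : Type} [AddCommGroup E] [Module ℂ E] [Module.Finite ℂ E]
      (ρ : Representation ℂ (FundamentalGroup X x) E) :
      (ofRepresentation ρ).HasRank (Module.finrank ℂ E) := fun z =>
    (Module.finrank_eq_rank ℂ E).symm
  rcases hk' with hk' | hk'
  · obtain ⟨L, W, hL, hLk, ⟨e'⟩⟩ := ih _ (hfr ▸ Submodule.finrank_lt hS1) hA (hrank ρ) hk'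
    exact ⟨L, W ⊞ ofRepresentation σ, hL, hLk,
      ⟨(biprod.associator _ _ _).symm ≪≫ biprod.mapIso e' (Iso.refl _) ≪≫ e⟩⟩
  · obtain ⟨L, W, hL, hLk, ⟨e'⟩⟩ := ih _ (hfr ▸ Submodule.finrank_lt hT1) hB (hrank σ) hk'
    exact ⟨L, W ⊞ ofRepresentation ρ, hL, hLk,
      ⟨(biprod.associator _ _ _).symm ≪≫ biprod.mapIso e' (Iso.refl _) ≪≫
        biprod.braiding _ _ ≪≫ e⟩⟩

end LocalSystems

/-! ### Local systems on a product of two spaces -/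

section Box

variable {Z X Y : Type u} [TopologicalSpace Z] [TopologicalSpace X] [TopologicalSpace Y]
  (p : C(Z, X)) (q : C(Z, Y))

/-- The map of fundamental groups induced by a pair of maps. -/
def fundamentalGroupPair (z : Z) :
    FundamentalGroup Z z →* FundamentalGroup X (p z) × FundamentalGroup Y (q z) :=
  (FundamentalGroup.map p z).prod (FundamentalGroup.map q z)

variable {p q}

/-- By surjectivity the monodromy has the same operators as the external tensor product of the two
monodromies. -/
lemma boxProduct_isSemisimple (h : ∀ z, Function.Surjective (fundamentalGroupPair p q z))
    {V : LocalSystem X} {W : LocalSystem Y} [∀ x, Module.Finite ℂ (V.obj x)]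
    (hV : V.IsSemisimple) (hW : W.IsSemisimple) : (boxProduct p q V W).IsSemisimple := fun z => by
  refine isSemisimple_of_linearEquiv (LinearEquiv.refl ℂ (V.obj ⟨p z⟩ ⊗[ℂ] W.obj ⟨q z⟩))
    (fun g => ⟨fundamentalGroupPair p q z g, fun x => rfl⟩) (fun g => ?_)
    (extTensor_isSemisimple (V.monodromy (p z)) (W.monodromy (q z)) (hV _) (hW _))
  obtain ⟨g', rfl⟩ := h z g
  exact ⟨g', fun x => rfl⟩

theorem exists_iso_boxProduct [PathConnectedSpace Z] [PathConnectedSpace X] [PathConnectedSpace Y]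
    (h : ∀ z, Function.Bijective (fundamentalGroupPair p q z)) {L : LocalSystem Z}
    (hL : L.IsIrreducible) (hfin : ∀ z, Module.Finite ℂ (L.obj z)) :
    ∃ (V : LocalSystem X) (W : LocalSystem Y), V.IsIrreducible ∧ W.IsIrreducible ∧
      (∀ x, Module.Finite ℂ (V.obj x)) ∧ (∀ y, Module.Finite ℂ (W.obj y)) ∧
      Nonempty (L ≅ boxProduct p q V W) := by
  obtain ⟨z⟩ := PathConnectedSpace.nonempty (X := Z)
  let φ := MulEquiv.ofBijective (fundamentalGroupPair p q z) (h z)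
  have := hfin ⟨z⟩
  let τ : Representation ℂ (FundamentalGroup X (p z) × FundamentalGroup Y (q z)) (L.obj ⟨z⟩) :=
    (L.monodromy z).comp φ.symm.toMonoidHom
  have hτ (g) : L.monodromy z g = τ (φ g) :=
    congrArg (L.monodromy z) (φ.symm_apply_apply g).symm
  have hirr : τ.IsIrreducible := isIrreducible_of_linearEquiv (LinearEquiv.refl ℂ _)
    (fun g => ⟨φ g, LinearMap.congr_fun (hτ g)⟩) (hL z)
  obtain ⟨U, M, _, _, _, _, hU, hM, ρ, σ, e, hρ, hσ, he⟩ :=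
    exists_extTensor_of_isIrreducible τ hirr
  refine ⟨ofRepresentation ρ, ofRepresentation σ, ofRepresentation_isIrreducible ρ hρ,
    ofRepresentation_isIrreducible σ hσ, fun _ => hU, fun _ => hM, ?_⟩
  have hiso : Nonempty (boxProduct p q (ofRepresentation ρ) (ofRepresentation σ) ≅ L) := by
    refine nonempty_iso_of_fibre_iso z ((TensorProduct.congr (ofRepresentationFibre ρ)
      (ofRepresentationFibre σ)).trans e) fun g x => ?_
    rw [hτ g]
    refine Eq.trans ?_ (he _ _ _)
    refine congrArg e ?_
    have h1 : TensorProduct.map (ofRepresentationFibre ρ).toLinearMap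
        (ofRepresentationFibre σ).toLinearMap ∘ₗ
          TensorProduct.map ((ofRepresentation ρ).monodromy (p z) (FundamentalGroup.map p z g))
            ((ofRepresentation σ).monodromy (q z) (FundamentalGroup.map q z g)) =
        TensorProduct.map (ρ (FundamentalGroup.map p z g)) (σ (FundamentalGroup.map q z g)) ∘ₗ
          TensorProduct.map (ofRepresentationFibre ρ).toLinearMap
            (ofRepresentationFibre σ).toLinearMap :=
      TensorProduct.ext' fun v w => congrArg₂ (· ⊗ₜ[ℂ] ·)
        (ofRepresentationFibre_monodromy ρ (FundamentalGroup.map p z g) v)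
        (ofRepresentationFibre_monodromy σ (FundamentalGroup.map q z g) w)
    exact LinearMap.congr_fun h1 x
  exact ⟨hiso.some.symm⟩

end Box

/-! ### Splitting off the first factor -/

section PiTensor

variable {N : ℕ} (M : Fin (N + 1) → Type) [∀ i, AddCommGroup (M i)] [∀ i, Module ℂ (M i)]

/-- Splitting off the first factor of a tensor product. -/
def piTensorSuccEquiv : (⨂[ℂ] i, M i) ≃ₗ[ℂ] M 0 ⊗[ℂ] (⨂[ℂ] i : Fin N, M i.succ) :=
  LinearEquiv.ofLinearMap
    (PiTensorProduct.lift (LinearMap.uncurryLeft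
      { toFun := fun v => (TensorProduct.mk ℂ (M 0) (⨂[ℂ] i : Fin N, M i.succ) v).compMultilinearMap
          (PiTensorProduct.tprod ℂ)
        map_add' := fun v w => by ext; simp
        map_smul' := fun c v => by ext; simp }))
    (TensorProduct.lift (PiTensorProduct.lift.toLinearMap ∘ₗ
      (PiTensorProduct.tprod ℂ : MultilinearMap ℂ M _).curryLeft))
    (TensorProduct.ext' fun v x => by
      induction x using PiTensorProduct.induction_on with
      | smul_tprod c f => simp
      | add x y hx hy => simp only [TensorProduct.tmul_add, map_add, hx, hy])
    (PiTensorProduct.ext (MultilinearMap.ext fun f => by simp [Fin.cons_self_tail]))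

lemma piTensorSuccEquiv_tprod (f : ∀ i, M i) :
    piTensorSuccEquiv M (PiTensorProduct.tprod ℂ f) =
      f 0 ⊗ₜ PiTensorProduct.tprod ℂ fun i : Fin N => f i.succ :=
  PiTensorProduct.lift.tprod f

end PiTensor

section Succ

variable {N : ℕ} (X : Fin (N + 1) → Type u) [∀ i, TopologicalSpace (X i)]

/-- Forgetting the first coordinate. -/
def tailMap : C(∀ i, X i, ∀ i : Fin N, X i.succ) := ⟨fun x i => x i.succ, by fun_prop⟩

lemma simplex_eval_tailMap_bijective (n : SimplexCategory) :
    Function.Bijective fun ρ : C(Simplex n, ∀ i, X i) =>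
      ((ContinuousMap.eval 0).comp ρ, (tailMap X).comp ρ) := by
  constructor
  · intro ρ ρ' h
    obtain ⟨h₁, h₂⟩ := Prod.mk.inj h
    ext t i
    refine Fin.cases ?_ (fun j => ?_) i
    · exact DFunLike.congr_fun h₁ t
    · exact congrFun (DFunLike.congr_fun h₂ t) j
  · rintro ⟨σ, τ⟩
    refine ⟨⟨fun t => Fin.cons (σ t) (τ t), continuous_pi fun i => ?_⟩, rfl⟩
    refine Fin.cases ?_ (fun j => ?_) i
    · exact σ.continuous
    · exact (continuous_apply j).comp τ.continuous

variable {X}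

lemma map_eval_map_tailMap {x y : FundamentalGroupoid (∀ i, X i)} (γ : x ⟶ y) (j : Fin N) :
    (FundamentalGroupoid.map (ContinuousMap.eval j)).map
      ((FundamentalGroupoid.map (tailMap X)).map γ) =
        (FundamentalGroupoid.map (ContinuousMap.eval j.succ)).map γ := by
  induction γ using Path.Homotopic.Quotient.ind with | mk γ => rfl

variable (X) in
lemma fundamentalGroupPair_eval_tailMap_bijective (z : ∀ i, X i) :
    Function.Bijective (fundamentalGroupPair (ContinuousMap.eval 0) (tailMap X) z) := by
  constructor
  · intro g g' h
    obtain ⟨h₁, h₂⟩ := Prod.mk.inj h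
    refine (Path.Homotopic.pi_proj g).symm.trans (Eq.trans ?_ (Path.Homotopic.pi_proj g'))
    refine congrArg Path.Homotopic.pi (funext fun i => ?_)
    refine Fin.cases ?_ (fun j => ?_) i
    · exact h₁
    · refine (map_eval_map_tailMap g j).symm.trans (Eq.trans ?_ (map_eval_map_tailMap g' j))
      exact congrArg (FundamentalGroupoid.map (ContinuousMap.eval j)).map h₂
  · rintro ⟨a, b⟩
    let c : ∀ i, Path.Homotopic.Quotient (z i) (z i) :=
      Fin.cases a fun j => Path.Homotopic.proj (X := fun j : Fin N => X j.succ) j b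
    let g : FundamentalGroup (∀ i, X i) z := Path.Homotopic.pi c
    refine ⟨g, Prod.ext (Path.Homotopic.proj_pi 0 c) ?_⟩
    refine (Path.Homotopic.pi_proj _).symm.trans (Eq.trans ?_ (Path.Homotopic.pi_proj b))
    refine congrArg Path.Homotopic.pi (funext fun j => ?_)
    exact (map_eval_map_tailMap g j).trans (Path.Homotopic.proj_pi j.succ c)

/-- An external tensor product as a product of two local systems. -/
def externalTensorSuccIso (V : ∀ i, LocalSystem (X i)) :
    externalTensor V ≅ boxProduct (ContinuousMap.eval 0) (tailMap X) (V 0)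
      (externalTensor fun i => V i.succ) :=
  NatIso.ofComponents (fun z => (piTensorSuccEquiv fun i => (V i).obj ⟨z.as i⟩).toModuleIso)
    fun {x y} γ => by
    refine ModuleCat.hom_ext (PiTensorProduct.ext (MultilinearMap.ext fun f => ?_))
    refine (congrArg (piTensorSuccEquiv fun i => (V i).obj ⟨y.as i⟩)
      (PiTensorProduct.map_tprod _ f)).trans ((piTensorSuccEquiv_tprod _ _).trans ?_)
    refine Eq.trans ?_ (congrArg (((boxProduct (ContinuousMap.eval 0) (tailMap X) (V 0)
      (externalTensor fun i => V i.succ)).map γ).hom) (piTensorSuccEquiv_tprod _ f)).symm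
    refine congrArg (_ ⊗ₜ[ℂ] ·) (Eq.trans ?_ (PiTensorProduct.map_tprod _ _).symm)
    refine congrArg (PiTensorProduct.tprod ℂ) (funext fun i => ?_)
    exact congrArg (fun α => ((V i.succ).map α).hom (f i.succ)) (map_eval_map_tailMap γ i).symm

end Succ

/-! ### Local systems on a one-point space -/

section Point

variable {Z : Type u} [TopologicalSpace Z] [Subsingleton Z]

instance (x y : FundamentalGroupoid Z) : Subsingleton (x ⟶ y) := by
  refine ⟨fun α β => ?_⟩
  induction α using Path.Homotopic.Quotient.ind with | mk α =>
  induction β using Path.Homotopic.Quotient.ind with | mk β =>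
  exact congrArg Path.Homotopic.Quotient.mk (Path.ext (funext fun _ => Subsingleton.elim _ _))

/-- A one-point space has one simplex in each degree and no nontrivial transport, so the cochains
are thin. This is the empty product in the Künneth theorem. -/
lemma isExactAt_iff_of_subsingleton [Nonempty Z] (V : LocalSystem Z)
    (hV : ∀ z, Nontrivial (V.obj z)) (k : ℕ) : IsExactAt (cochainSpace V) k ↔ k ≠ 0 := by
  have key {m : SimplexCategory} (c : SingularCochain V m) {z : FundamentalGroupoid Z}
      (s t : C(Simplex m, Z)) (α : ⟨s (vertexZero m)⟩ ⟶ z) (β : ⟨t (vertexZero m)⟩ ⟶ z) :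
      (V.map α).hom (c s) = (V.map β).hom (c t) := by
    obtain rfl : s = t := ContinuousMap.ext fun _ => Subsingleton.elim _ _
    rw [Subsingleton.elim α β]
  have hmap {m n : SimplexCategory} (f g : m ⟶ n) : cochainMap V f = cochainMap V g :=
    LinearMap.ext fun c => funext fun σ => key c (σ.comp (simplexMap f)) (σ.comp (simplexMap g))
      ((FundamentalGroupoid.map σ).map (simplexPath (simplexMap f (vertexZero m)) (vertexZero n)))
      ((FundamentalGroupoid.map σ).map (simplexPath (simplexMap g (vertexZero m)) (vertexZero n)))
  rw [isExactAt_of_thin _ fun f g => congrArg ModuleCat.ofHom (hmap f g), or_iff_left]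
  rw [not_subsingleton_iff_nontrivial]
  have := fun σ : C(Simplex ⦋0⦌, Z) => hV ⟨σ (vertexZero ⦋0⦌)⟩
  exact Pi.nontrivial_at (f := fun σ : C(Simplex ⦋0⦌, Z) => V.obj ⟨σ (vertexZero ⦋0⦌)⟩)
    (.const _ (Classical.arbitrary Z))

lemma isIrreducible_iff_finrank_eq_one {G E : Type*} [Monoid G] [Subsingleton G] [AddCommGroup E]
    [Module ℂ E] (ρ : Representation ℂ G E) : ρ.IsIrreducible ↔ Module.finrank ℂ E = 1 := by
  have hρ (g : G) (x : E) : ρ g x = x := by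
    rw [Subsingleton.elim g 1, map_one]
    rfl
  rw [isIrreducible_iff, ← isSimpleModule_iff_finrank_eq_one]
  constructor
  · rintro ⟨h, h'⟩
    exact (isSimpleModule_iff ℂ E).2
      { eq_bot_or_eq_top := fun S => h' S fun g x hx => (hρ g x).symm ▸ hx }
  · intro h
    exact ⟨IsSimpleModule.nontrivial ℂ E, fun S _ => eq_bot_or_eq_top S⟩

end Point

lemma LocalSystem.HasRank.pos {X : Type u} [TopologicalSpace X] [Nonempty X] {V : LocalSystem X}
    {n : ℕ} (h : V.HasRank n) (hV : V.IsIrreducible) : 0 < n := by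
  obtain ⟨x⟩ := ‹Nonempty X›
  have := ((isIrreducible_iff _).1 (hV x)).1
  have h1 := (rank_pos_iff_nontrivial (R := ℂ)).2 this
  rw [h x] at h1
  exact_mod_cast h1

/-- A summand of a system of finite rank has finite fibres, and path-connectedness makes their
dimension constant. -/
lemma exists_hasRank_of_biprod {X : Type u} [TopologicalSpace X] [PathConnectedSpace X]
    {V W : LocalSystem X} {n : ℕ} (h : (V ⊞ W).HasRank n) :
    ∃ m, m ≤ n ∧ V.HasRank m ∧ W.HasRank (n - m) := by
  obtain ⟨x⟩ := PathConnectedSpace.nonempty (X := X)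
  have := h.finite ⟨x⟩
  have : Module.Finite ℂ (V.obj ⟨x⟩ × W.obj ⟨x⟩) := .equiv (biprodFibreEquiv V W ⟨x⟩)
  have : Module.Finite ℂ (V.obj ⟨x⟩) := .of_surjective (LinearMap.fst ℂ _ (W.obj ⟨x⟩))
    LinearMap.fst_surjective
  have hV := hasRank_of_finite (V := V) (x := x)
  refine ⟨_, ?_, hV, h.right hV⟩
  have h1 := (biprodFibreEquiv V W ⟨x⟩).rank_eq
  rw [rank_prod', h x, hV x] at h1
  exact_mod_cast (self_le_add_right _ _).trans h1.ge

/-! ### External tensor products -/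

/-- Isomorphic local systems have isomorphic products with a fixed one. -/
def boxProductIso {Z X Y : Type u} [TopologicalSpace Z] [TopologicalSpace X] [TopologicalSpace Y]
    (p : C(Z, X)) (q : C(Z, Y)) (V : LocalSystem X) {W W' : LocalSystem Y} (e : W ≅ W') :
    boxProduct p q V W ≅ boxProduct p q V W' :=
  NatIso.ofComponents (fun z => (TensorProduct.congr (LinearEquiv.refl ℂ (V.obj ⟨p z.as⟩))
    (e.app ⟨q z.as⟩).toLinearEquiv).toModuleIso) fun γ =>
      ModuleCat.hom_ext (TensorProduct.ext' fun _ w => congrArg (_ ⊗ₜ[ℂ] ·)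
        (congrArg (fun φ => φ.hom w) (e.hom.naturality ((FundamentalGroupoid.map q).map γ))))

section ExternalTensor

variable {N : ℕ} {X : Fin N → Type u} [∀ i, TopologicalSpace (X i)]

lemma externalTensor_hasRank {V : ∀ i, LocalSystem (X i)} {r : Fin N → ℕ}
    (h : ∀ i, (V i).HasRank (r i)) : (externalTensor V).HasRank (∏ i, r i) := fun x => by
  have hfin (i) := (h i).finite ⟨x i⟩
  have hr (i) : Module.finrank ℂ ((V i).obj ⟨x i⟩) = r i := Module.finrank_eq_of_rank_eq (h i (x i))
  refine (rank_eq_card_basis (Basis.piTensorProduct fun i =>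
    Module.finBasis ℂ ((V i).obj ⟨x i⟩))).trans ?_
  simp [hr]

lemma finrank_externalTensor_of_isEmpty {X : Fin 0 → Type u} [∀ i, TopologicalSpace (X i)]
    (V : ∀ i, LocalSystem (X i)) (x) : Module.finrank ℂ ((externalTensor V).obj x) = 1 :=
  (PiTensorProduct.isEmptyEquiv (R := ℂ) (s := fun i => (V i).obj ⟨x.as i⟩)
    (Fin 0)).finrank_eq.trans (Module.finrank_self ℂ)

/-- The Künneth theorem. -/
theorem not_isExactAt_externalTensor_iff (V : ∀ i, LocalSystem (X i))
    (hV : ∀ i x, Module.Finite ℂ ((V i).obj x)) (k : ℕ) :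
    ¬ IsExactAt (cochainSpace (externalTensor V)) k ↔
      ∃ d : Fin N → ℕ, ∑ i, d i = k ∧ ∀ i, ¬ IsExactAt (cochainSpace (V i)) (d i) := by
  induction N generalizing k with
  | zero =>
    rw [isExactAt_iff_of_subsingleton _ fun z => Module.nontrivial_of_finrank_pos (R := ℂ)
      (by rw [finrank_externalTensor_of_isEmpty]; exact one_pos)]
    simp [eq_comm]
  | succ N ih =>
    have := hV 0
    rw [isExactAt_cochainSpace_congr (externalTensorSuccIso V),
      isExactAt_boxProduct_iff _ _ _ _ (simplex_eval_tailMap_bijective X)]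
    push Not
    constructor
    · rintro ⟨i, j, rfl, hi, hj⟩
      obtain ⟨d, rfl, hd⟩ := (ih _ (fun i => hV i.succ) j).1 hj
      exact ⟨Fin.cons i d, by simp [Fin.sum_univ_succ], Fin.cases hi hd⟩
    · rintro ⟨d, rfl, hd⟩
      exact ⟨d 0, ∑ i : Fin N, d i.succ, (Fin.sum_univ_succ d).symm, hd 0,
        (ih _ (fun i => hV i.succ) _).2 ⟨_, rfl, fun i => hd i.succ⟩⟩

theorem externalTensor_isSemisimple {V : ∀ i, LocalSystem (X i)}
    (hfin : ∀ i x, Module.Finite ℂ ((V i).obj x)) (hV : ∀ i, (V i).IsSemisimple) :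
    (externalTensor V).IsSemisimple := by
  induction N with
  | zero =>
    have h : (externalTensor V).IsIrreducible := fun z =>
      (isIrreducible_iff_finrank_eq_one _).2 (finrank_externalTensor_of_isEmpty V _)
    exact h.isSemisimple
  | succ N ih =>
    have := hfin 0
    exact (boxProduct_isSemisimple (fun z => (fundamentalGroupPair_eval_tailMap_bijective X z).2)
      (hV 0) (ih (fun i => hfin i.succ) fun i => hV i.succ)).congr (externalTensorSuccIso V).symm

theorem exists_iso_externalTensor [∀ i, PathConnectedSpace (X i)] {L : LocalSystem (∀ i, X i)}
    (hL : L.IsIrreducible) (hfin : ∀ x, Module.Finite ℂ (L.obj x)) :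
    ∃ V : ∀ i, LocalSystem (X i), (∀ i, (V i).IsIrreducible) ∧
      (∀ i x, Module.Finite ℂ ((V i).obj x)) ∧ Nonempty (L ≅ externalTensor V) := by
  induction N with
  | zero =>
    refine ⟨fun i => i.elim0, fun i => i.elim0, fun i => i.elim0, ?_⟩
    let x : ∀ i, X i := fun i => i.elim0
    have := hfin ⟨x⟩
    have h1 := (isIrreducible_iff_finrank_eq_one _).1 (hL x)
    have h2 := finrank_externalTensor_of_isEmpty (X := X) (fun i => i.elim0) ⟨x⟩
    have := Module.finite_of_finrank_eq_succ h2
    refine nonempty_iso_of_fibre_iso x (LinearEquiv.ofFinrankEq _ _ (h1.trans h2.symm))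
      fun g v => ?_
    rw [Subsingleton.elim g 1, map_one, map_one]
    rfl
  | succ N ih =>
    obtain ⟨V, W, hV, hW, hVf, hWf, ⟨e⟩⟩ :=
      exists_iso_boxProduct (fundamentalGroupPair_eval_tailMap_bijective X) hL hfin
    obtain ⟨V', hV', hVf', ⟨e'⟩⟩ := ih hW hWf
    refine ⟨Fin.cons V V', Fin.cases hV hV', Fin.cases hVf hVf', ⟨e ≪≫ ?_⟩⟩
    exact boxProductIso _ _ V e' ≪≫ (externalTensorSuccIso (Fin.cons V V')).symm

end ExternalTensor

/-! ### Support loci of a product -/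

theorem supportLocus_pi {N : ℕ} (X : Fin N → Type u) [∀ i, TopologicalSpace (X i)]
    [∀ i, PathConnectedSpace (X i)] (k n : ℕ) :
    supportLocus 1 k (∀ i, X i) n =
      ⋃ (d : Fin N → ℕ) (_ : ∑ i, d i = k)
        (r : Fin N → ℕ) (_ : (∀ i, 0 < r i) ∧ ∏ i, r i ≤ n),
        Set.image2 directSum
          (tensor '' Set.univ.pi fun i => supportLocus 1 (d i) (X i) (r i))
          (bettiModuli (∀ i, X i) (n - ∏ i, r i)) := by
  ext c
  simp only [Set.mem_iUnion]
  constructor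
  · rintro ⟨V, rfl, hr, hs, hk⟩
    rw [one_le_rank_cohomology_iff] at hk
    obtain ⟨L, W, hL, hLk, ⟨e⟩⟩ := exists_irreducible_summand hs hr hk
    obtain ⟨m, hm, hLr, hWr⟩ := exists_hasRank_of_biprod (hr.congr e.symm)
    have hWs := (hs.congr e.symm).of_epi biprod.snd biprod.inr biprod.inr_snd
    obtain ⟨M, hM, hMf, ⟨e'⟩⟩ := exists_iso_externalTensor hL hLr.finite
    rw [isExactAt_cochainSpace_congr e', not_isExactAt_externalTensor_iff M hMf] at hLk
    obtain ⟨d, hd, hMk⟩ := hLk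
    have hMr (i) : ∃ r, (M i).HasRank r := by
      have := hMf i ⟨Classical.arbitrary (X i)⟩
      exact ⟨_, hasRank_of_finite (x := Classical.arbitrary (X i))⟩
    choose r hr' using hMr
    -- The fibre of `L` at one point has rank `m` by the splitting, and the product of the ranks by
    -- the tensor decomposition.
    obtain rfl : m = ∏ i, r i := by
      have h := (hLr.congr e' (fun i => Classical.arbitrary (X i))).symm.trans
        (externalTensor_hasRank hr' _)
      exact_mod_cast h
    refine ⟨d, hd, r, ⟨fun i => (hr' i).pos (hM i), hm⟩, tensor fun i => IsoClass.mk (M i),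
      ⟨_, fun i _ => ⟨M i, rfl, hr' i, (hM i).isSemisimple,
        (one_le_rank_cohomology_iff _ _).2 (hMk i)⟩, rfl⟩, IsoClass.mk W, ⟨W, rfl, hWr, hWs⟩, ?_⟩
    rw [tensor_mk]
    exact Quotient.sound ⟨biprod.mapIso e'.symm (Iso.refl W) ≪≫ e⟩
  · rintro ⟨d, rfl, r, ⟨-, hle⟩, _, ⟨c, hc, rfl⟩, _, ⟨W, rfl, hWr, hWs⟩, rfl⟩
    choose V hV hr hs hk using fun i => hc i trivial
    obtain rfl : c = fun i => IsoClass.mk (V i) := funext hV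
    have hfin (i) := (hr i).finite
    refine ⟨externalTensor V ⊞ W, by rw [tensor_mk]; rfl, ?_,
      (externalTensor_isSemisimple hfin hs).biprod hWs, ?_⟩
    · have h := (externalTensor_hasRank hr).biprod hWr
      -- The truncated subtraction in the rank of the complement is a true one because the product
      -- of the ranks is at most `n`.
      rwa [Nat.add_sub_cancel' hle] at h
    · rw [one_le_rank_cohomology_iff, isExactAt_biprod_iff, not_and_or]
      exact Or.inl ((not_isExactAt_externalTensor_iff V hfin _).2
        ⟨d, rfl, fun i => (one_le_rank_cohomology_iff _ _).1 (hk i)⟩)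

end BettiLocus

end

theorem mainTheorem12 {N : ℕ} (X : Fin N → Type u) [∀ i, TopologicalSpace (X i)]
    [∀ i, PathConnectedSpace (X i)] (k n : ℕ) :
    BettiLocus.supportLocus 1 k (∀ i, X i) n =
      ⋃ (d : Fin N → ℕ) (_ : ∑ i, d i = k)
        (r : Fin N → ℕ) (_ : (∀ i, 0 < r i) ∧ ∏ i, r i ≤ n),
        Set.image2 BettiLocus.directSum
          (BettiLocus.tensor '' Set.univ.pi fun i => BettiLocus.supportLocus 1 (d i) (X i) (r i))
          (BettiLocus.bettiModuli (∀ i, X i) (n - ∏ i, r i)) :=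
  BettiLocus.supportLocus_pi X k n
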